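/- Let $H$ be a separable complex Hilbert space with an orthogonal decomposition $H=H_+\oplus H_-$ into two closed infinite-dimensional subspaces, with orthogonal projections $p_\pm$ onto $H_\pm$. Write $L^1(H_+)$ for the Banach space of trace class operators on $H_+$ with norm $\mathrm{Tr}\,|T|$, $L^2(H_+,H_-)$ for the Hilbert–Schmidt operators from $H_+$ to $H_-$, $B(H_+,H)$ for the bounded operators, $\mathcal S^1(H_+)\subset L^1(H_+)$ for the real subspace of self-adjoint operators, and $\mathfrak g\subset L^1(H_+)$ for the real subspace of skew-Hermitian operators, with real topological dual $\mathfrak g'$. For $k\in\mathbb R\setminus\{0\}$ let $$\mathcal M_k=\{x\in B(H_+,H)\;:\;p_+x-k\,\mathrm{Id}\in L^1(H_+),\ p_-x\in L^2(H_+,H_-)\},$$ an affine Banach space modelled on $L^1(H_+)\times L^2(H_+,H_-)$, and let $$T\mathcal M_k=\{(x,X)\;:\;x\in\mathcal M_k,\ X\in B(H_+,H),\ p_+X\in L^1(H_+),\ p_-X\in L^2(H_+,H_-)\},$$ with the constant weak Riemannian metric $\mathrm g((Z_1,T_1),(Z_2,T_2))=\Re\,\mathrm{Tr}\,Z_1^*Z_2+\Re\,\mathrm{Tr}\,T_1^*T_2$.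 Let $\mu=(\mu_1,\mu_2,\mu_3):T\mathcal M_k\to(\mathfrak g')^3$ be given, for $\mathfrak a\in\mathfrak g$, by $$\mu_1(x,X)(\mathfrak a)=-\tfrac i2\mathrm{Tr}\big((x^*x-X^*X)\mathfrak a\big),\quad \mu_2(x,X)(\mathfrak a)=\tfrac12\mathrm{Tr}\big((X^*x-x^*X)\mathfrak a\big),\quad \mu_3(x,X)(\mathfrak a)=-\tfrac i2\mathrm{Tr}\big((X^*x+x^*X)\mathfrak a\big).$$ Then the level set $\mathcal W_k=\mu^{-1}\big(-\tfrac i2k^2\,\mathrm{Tr},0,0\big)$ is a smooth Riemannian submanifold of $T\mathcal M_k$: around each of its points there is a smooth chart of $T\mathcal M_k$ that straightens $\mathcal W_k$ to a closed complemented real subspace of the model space, and in every such chart the restriction of $\mathrm g$ to the tangent spaces of $\mathcal W_k$ is a smooth, symmetric, positive definite form. Moreover the map $$\mathcal F:T\mathcal M_k\to L^1(H_+)\times\big(k^2\,\mathrm{Id}+\mathcal S^1(H_+)\big),\qquad \mathcal F(x,X)=(X^*x,\;x^*x-X^*X),$$ is smooth, and at every point of $\mathcal W_k$ its differential is surjective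 onto $L^1(H_+)\times\mathcal S^1(H_+)$, and the kernel of the differential has a closed complement in the tangent space of $T\mathcal M_k$, namely its orthogonal complement with respect to $\mathrm g$. -/

import Mathlib

open Set Filter Topology Manifold
open scoped ContDiff ENNReal NNReal InnerProductSpace

set_option maxSynthPendingDepth 3
set_option linter.unusedSectionVars false

noncomputable section

namespace HilbertIdeal

section Schatten

variable {E F G : Type*}
  [NormedAddCommGroup E] [InnerProductSpace ℂ E] [CompleteSpace E]
  [NormedAddCommGroup F] [InnerProductSpace ℂ F] [CompleteSpace F]
  [NormedAddCommGroup G] [InnerProductSpace ℂ G] [CompleteSpace G]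

/-- The index set of the chosen Hilbert basis of `E`. -/
def BasisIndex (E : Type*) [NormedAddCommGroup E] [InnerProductSpace ℂ E] [CompleteSpace E] :
    Set E := (exists_hilbertBasis ℂ E).choose

/-- A chosen Hilbert basis of `E`. -/
def onb (E : Type*) [NormedAddCommGroup E] [InnerProductSpace ℂ E] [CompleteSpace E] :
    HilbertBasis (BasisIndex E) ℂ E := (exists_hilbertBasis ℂ E).choose_spec.choose

/-- The square of the Hilbert-Schmidt norm, `∑ ‖T eᵢ‖²`, as an extended number. -/
def hsSq (T : E →L[ℂ] F) : ℝ≥0∞ := ∑' i, ‖T (onb E i)‖ₑ ^ 2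

/-- The trace norm `Tr |T| = ∑ ⟪eᵢ, |T| eᵢ⟫`, where `|T| = (T* T)^{1/2}`, as an extended number. -/
def traceNorm (T : E →L[ℂ] E) : ℝ≥0∞ :=
  ∑' i, ENNReal.ofReal (RCLike.re ⟪onb E i, CFC.abs T (onb E i)⟫_ℂ)

theorem parseval {ι : Type*} (b : HilbertBasis ι ℂ F) (x : F) :
    ‖x‖ₑ ^ 2 = ∑' j, ‖⟪b j, x⟫_ℂ‖ₑ ^ 2 := by
  have h := b.hasSum_inner_mul_inner x x
  have h2 : HasSum (fun i => ‖⟪b i, x⟫_ℂ‖ ^ 2) (‖x‖ ^ 2) := by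
    have h3 := (Complex.hasSum_re h)
    convert h3 using 1
    · ext i
      rw [← inner_conj_symm x (b i), mul_comm, Complex.mul_conj, Complex.normSq_eq_norm_sq,
        Complex.ofReal_re]
    · rw [inner_self_eq_norm_sq_to_K]
      norm_cast
  have h4 := ENNReal.ofReal_tsum_of_nonneg (fun i => by positivity) h2.summable
  rw [h2.tsum_eq] at h4
  simpa [ENNReal.ofReal_pow, ofReal_norm] using h4

theorem hsSq_eq_of_basis {ι : Type*} (c : HilbertBasis ι ℂ F) (T : E →L[ℂ] F) :
    hsSq T = ∑' j, ‖(ContinuousLinearMap.adjoint T) (c j)‖ₑ ^ 2 := by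
  unfold hsSq
  simp_rw [parseval c (T _)]
  rw [ENNReal.tsum_comm]
  refine tsum_congr fun j => ?_
  rw [parseval (onb E)]
  refine tsum_congr fun i => ?_
  rw [ContinuousLinearMap.adjoint_inner_right, ← inner_conj_symm]
  congr 1
  exact RCLike.enorm_conj _

theorem hsSq_adjoint (T : E →L[ℂ] F) : hsSq (ContinuousLinearMap.adjoint T) = hsSq T :=
  (hsSq_eq_of_basis (onb F) T).symm

theorem hsSq_comp_le_left (A : F →L[ℂ] G) (B : E →L[ℂ] F) :
    hsSq (A ∘L B) ≤ ‖A‖ₑ ^ 2 * hsSq B := by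
  unfold hsSq
  rw [← ENNReal.tsum_mul_left]
  refine ENNReal.tsum_le_tsum fun i => ?_
  rw [← mul_pow]
  gcongr
  exact A.le_opENorm _

theorem hsSq_comp_le_right (A : F →L[ℂ] G) (B : E →L[ℂ] F) :
    hsSq (A ∘L B) ≤ ‖B‖ₑ ^ 2 * hsSq A := by
  rw [← hsSq_adjoint (A ∘L B), ContinuousLinearMap.adjoint_comp, ← hsSq_adjoint A]
  refine (hsSq_comp_le_left _ _).trans_eq ?_
  rw [show ‖ContinuousLinearMap.adjoint B‖ₑ = ‖B‖ₑ by
    simp [← ofReal_norm]]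

theorem tsum_mul_le {ι : Type*} (f g : ι → ℝ≥0∞) :
    ∑' i, f i * g i ≤ (∑' i, f i ^ 2) ^ (1 / 2 : ℝ) * (∑' i, g i ^ 2) ^ (1 / 2 : ℝ) := by
  rw [ENNReal.tsum_eq_iSup_sum]
  refine iSup_le fun s => ?_
  refine (ENNReal.inner_le_Lp_mul_Lq s f g Real.HolderConjugate.two_two).trans ?_
  simp only [ENNReal.rpow_ofNat]
  gcongr <;> exact ENNReal.sum_le_tsum s

theorem exists_polar (T : E →L[ℂ] E) :
    ∃ U : E →L[ℂ] E, ‖U‖ ≤ 1 ∧ T = U ∘L CFC.abs T ∧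
      CFC.abs T = (ContinuousLinearMap.adjoint U) ∘L T := by
  set A := CFC.abs T with hA
  have hAsa : IsSelfAdjoint A := (CFC.abs_nonneg T).isSelfAdjoint
  have hAadj : ContinuousLinearMap.adjoint A = A := hAsa
  have hAA : A ∘L A = (ContinuousLinearMap.adjoint T) ∘L T := CFC.abs_mul_abs T
  have hin : ∀ x y, ⟪A x, A y⟫_ℂ = ⟪T x, T y⟫_ℂ := by
    intro x y
    have := congrArg (fun B : E →L[ℂ] E => ⟪x, B y⟫_ℂ) hAA
    simp only [ContinuousLinearMap.comp_apply, ContinuousLinearMap.adjoint_inner_right] at this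
    rw [← this]
    conv_lhs => rw [← hAadj, ContinuousLinearMap.adjoint_inner_left, hAadj]
  have hnorm : ∀ x, ‖T x‖ ≤ 1 * ‖A x‖ := by
    intro x
    rw [one_mul, @norm_eq_sqrt_re_inner ℂ, @norm_eq_sqrt_re_inner ℂ _ _ _ _ (A x), hin]
  let K : Submodule ℂ E := (LinearMap.range (A : E →ₗ[ℂ] E)).topologicalClosure
  have hK : ∀ x, A x ∈ K := fun x => Submodule.le_topologicalClosure _ ⟨x, rfl⟩
  have : CompleteSpace K := (Submodule.isClosed_topologicalClosure _).completeSpace_coe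
  let e : E →ₗ[ℂ] K := (A : E →ₗ[ℂ] E).codRestrict K hK
  have hdense : DenseRange e := by
    intro y
    rw [closure_subtype]
    have hy : (y : E) ∈ closure (LinearMap.range (A : E →ₗ[ℂ] E) : Set E) := y.2
    refine closure_mono ?_ hy
    rintro _ ⟨x, rfl⟩
    exact ⟨e x, ⟨x, rfl⟩, rfl⟩
  let V : K →L[ℂ] E := (T : E →ₗ[ℂ] E).extendOfNorm e
  have hV : ∀ x, V (e x) = T x := fun x =>
    LinearMap.extendOfNorm_eq (f := (T : E →ₗ[ℂ] E)) hdense ⟨1, hnorm⟩ x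
  have hVn : ‖V‖ ≤ 1 :=
    LinearMap.opNorm_extendOfNorm_le (f := (T : E →ₗ[ℂ] E)) hdense zero_le_one hnorm
  have hVin : ∀ (y : K) (x : E), ⟪V y, T x⟫_ℂ = ⟪(y : E), A x⟫_ℂ := by
    intro y x
    refine hdense.induction_on (p := fun y : K => ⟪V y, T x⟫_ℂ = ⟪(y : E), A x⟫_ℂ) y ?_ ?_
    · exact isClosed_eq (by fun_prop) (by fun_prop)
    · intro z
      rw [hV]
      exact (hin z x).symm
  refine ⟨V ∘L K.orthogonalProjectionOnto, ?_, ?_, ?_⟩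
  · refine (ContinuousLinearMap.opNorm_comp_le _ _).trans ?_
    exact mul_le_one₀ hVn (norm_nonneg _) (Submodule.orthogonalProjectionOnto_norm_le _)
  · ext x
    have h1 : K.orthogonalProjectionOnto (A x) = e x :=
      Submodule.orthogonalProjectionOnto_mem_subspace_eq_self (e x)
    simp only [ContinuousLinearMap.comp_apply]
    rw [h1, hV]
  · ext x
    refine ext_inner_left ℂ fun y => ?_
    rw [ContinuousLinearMap.comp_apply, ContinuousLinearMap.adjoint_inner_right,
      ContinuousLinearMap.comp_apply, hVin]
    exact (Submodule.inner_orthogonalProjectionOnto_eq_of_mem_right (⟨A x, hK x⟩ : K) y).symm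

theorem traceNorm_eq_hsSq (T : E →L[ℂ] E) : traceNorm T = hsSq (CFC.sqrt (CFC.abs T)) := by
  have hsa : IsSelfAdjoint (CFC.sqrt (CFC.abs T)) := (CFC.sqrt_nonneg _).isSelfAdjoint
  have hadj : ContinuousLinearMap.adjoint (CFC.sqrt (CFC.abs T)) = CFC.sqrt (CFC.abs T) := hsa
  have hsq : CFC.sqrt (CFC.abs T) ∘L CFC.sqrt (CFC.abs T) = CFC.abs T :=
    CFC.sqrt_mul_sqrt_self _ (CFC.abs_nonneg T)
  unfold traceNorm hsSq
  refine tsum_congr fun i => ?_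
  have h := ContinuousLinearMap.adjoint_inner_right (CFC.sqrt (CFC.abs T)) (onb E i)
    (CFC.sqrt (CFC.abs T) (onb E i))
  rw [hadj, ← ContinuousLinearMap.comp_apply, hsq] at h
  rw [h, inner_self_eq_norm_sq, ENNReal.ofReal_pow (norm_nonneg _), ofReal_norm]

/-- The basic estimate `∑ |⟪eᵢ, S T R eᵢ⟫| ≤ ‖S‖ ‖R‖ Tr |T|`. -/
theorem tsum_enorm_inner_le (S T R : E →L[ℂ] E) :
    ∑' i, ‖⟪onb E i, S (T (R (onb E i)))⟫_ℂ‖ₑ ≤ ‖S‖ₑ * ‖R‖ₑ * traceNorm T := by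
  obtain ⟨U, hU, hT, -⟩ := exists_polar T
  set P := CFC.sqrt (CFC.abs T) with hP
  have hadj : ContinuousLinearMap.adjoint P = P :=
    (CFC.sqrt_nonneg (CFC.abs T)).isSelfAdjoint
  have hsq : P ∘L P = CFC.abs T := CFC.sqrt_mul_sqrt_self _ (CFC.abs_nonneg T)
  have hen : ∀ B : E →L[ℂ] E, ‖ContinuousLinearMap.adjoint B‖ₑ = ‖B‖ₑ := fun B => by
    simp [← ofReal_norm]
  set Q := (P ∘L ContinuousLinearMap.adjoint U) ∘L ContinuousLinearMap.adjoint S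
  have h1 : ∀ i, ‖⟪onb E i, S (T (R (onb E i)))⟫_ℂ‖ₑ ≤
      ‖Q (onb E i)‖ₑ * ‖(P ∘L R) (onb E i)‖ₑ := by
    intro i
    have : ⟪onb E i, S (T (R (onb E i)))⟫_ℂ = ⟪Q (onb E i), (P ∘L R) (onb E i)⟫_ℂ := by
      simp only [Q, ContinuousLinearMap.comp_apply]
      conv_lhs => rw [hT, ← hsq]
      conv_rhs => rw [← hadj]
      rw [ContinuousLinearMap.adjoint_inner_left, ContinuousLinearMap.adjoint_inner_left,
        ContinuousLinearMap.adjoint_inner_left, hadj]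
      rfl
    rw [this, ← ofReal_norm, ← ofReal_norm (Q _), ← ofReal_norm ((P ∘L R) _),
      ← ENNReal.ofReal_mul (norm_nonneg _)]
    exact ENNReal.ofReal_le_ofReal (norm_inner_le_norm _ _)
  have hQ : hsSq Q ≤ ‖S‖ₑ ^ 2 * traceNorm T := by
    refine (hsSq_comp_le_right _ _).trans ?_
    rw [hen]
    gcongr
    refine (hsSq_comp_le_right _ _).trans ?_
    rw [hen, traceNorm_eq_hsSq]
    have : ‖U‖ₑ ≤ 1 := by
      rw [← ofReal_norm]; exact ENNReal.ofReal_le_one.2 hU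
    calc ‖U‖ₑ ^ 2 * hsSq P ≤ 1 ^ 2 * hsSq P := by gcongr
      _ = hsSq P := by simp
  have hR : hsSq (P ∘L R) ≤ ‖R‖ₑ ^ 2 * traceNorm T := by
    rw [traceNorm_eq_hsSq]; exact hsSq_comp_le_right _ _
  refine (ENNReal.tsum_le_tsum h1).trans ((tsum_mul_le _ _).trans ?_)
  calc (hsSq Q) ^ (1 / 2 : ℝ) * (hsSq (P ∘L R)) ^ (1 / 2 : ℝ)
      ≤ (‖S‖ₑ ^ 2 * traceNorm T) ^ (1 / 2 : ℝ) * (‖R‖ₑ ^ 2 * traceNorm T) ^ (1 / 2 : ℝ) := by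
        gcongr
    _ = ‖S‖ₑ * ‖R‖ₑ * traceNorm T := by
        have h2 : (2 : ℝ)⁻¹ + 2⁻¹ = 1 := by norm_num
        rw [ENNReal.mul_rpow_of_nonneg _ _ (by norm_num),
          ENNReal.mul_rpow_of_nonneg _ _ (by norm_num), ← ENNReal.rpow_natCast_mul,
          ← ENNReal.rpow_natCast_mul]
        have h3 : traceNorm T ^ (1 / 2 : ℝ) * traceNorm T ^ (1 / 2 : ℝ) = traceNorm T := by
          rw [← ENNReal.rpow_add_of_nonneg _ _ (by norm_num) (by norm_num)]
          norm_num
        norm_num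
        norm_num at h3
        rw [mul_mul_mul_comm, h3]

/-- Dual characterisation of the trace norm. -/
theorem traceNorm_le {T : E →L[ℂ] E} {C : ℝ≥0∞}
    (h : ∀ S : E →L[ℂ] E, ‖S‖ ≤ 1 → ∑' i, ‖⟪onb E i, S (T (onb E i))⟫_ℂ‖ₑ ≤ C) :
    traceNorm T ≤ C := by
  obtain ⟨U, hU, -, hT⟩ := exists_polar T
  refine le_trans (ENNReal.tsum_le_tsum fun i => ?_)
    (h (ContinuousLinearMap.adjoint U) (by simpa using hU))
  rw [hT, ← ofReal_norm]
  exact ENNReal.ofReal_le_ofReal (RCLike.re_le_norm _)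

theorem enorm_le_one {S : E →L[ℂ] E} (hS : ‖S‖ ≤ 1) : ‖S‖ₑ ≤ 1 := by
  rw [← ofReal_norm]; exact ENNReal.ofReal_le_one.2 hS

theorem enorm_one_le : ‖(1 : E →L[ℂ] E)‖ₑ ≤ 1 :=
  enorm_le_one ContinuousLinearMap.norm_id_le

theorem traceNorm_comp_le (S T R : E →L[ℂ] E) :
    traceNorm (S ∘L T ∘L R) ≤ ‖S‖ₑ * ‖R‖ₑ * traceNorm T := by
  refine traceNorm_le fun W hW => ?_
  refine (tsum_enorm_inner_le (W ∘L S) T R).trans ?_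
  gcongr
  rw [← ofReal_norm, ← ofReal_norm]
  refine ENNReal.ofReal_le_ofReal ((ContinuousLinearMap.opNorm_comp_le _ _).trans ?_)
  exact mul_le_of_le_one_left (norm_nonneg _) hW

theorem traceNorm_comp_le_left (S T : E →L[ℂ] E) :
    traceNorm (S ∘L T) ≤ ‖S‖ₑ * traceNorm T := by
  refine (traceNorm_comp_le S T 1).trans ?_
  gcongr
  exact mul_le_of_le_one_right' enorm_one_le

theorem traceNorm_comp_le_right (T R : E →L[ℂ] E) :
    traceNorm (T ∘L R) ≤ ‖R‖ₑ * traceNorm T := by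
  refine (traceNorm_comp_le 1 T R).trans ?_
  gcongr
  exact mul_le_of_le_one_left' enorm_one_le

theorem tsum_enorm_inner_le_traceNorm (T : E →L[ℂ] E) :
    ∑' i, ‖⟪onb E i, T (onb E i)⟫_ℂ‖ₑ ≤ traceNorm T := by
  refine (tsum_enorm_inner_le 1 T 1).trans ?_
  calc _ ≤ 1 * 1 * traceNorm T := by gcongr <;> exact enorm_one_le
    _ = _ := by simp

theorem traceNorm_add_le (S T : E →L[ℂ] E) :
    traceNorm (S + T) ≤ traceNorm S + traceNorm T := by
  refine traceNorm_le fun W hW => ?_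
  have key : ∀ T : E →L[ℂ] E, ∑' i, ‖⟪onb E i, W (T (onb E i))⟫_ℂ‖ₑ ≤ traceNorm T := fun T => by
    refine (tsum_enorm_inner_le_traceNorm (W ∘L T)).trans ((traceNorm_comp_le_left _ _).trans ?_)
    exact mul_le_of_le_one_left' (enorm_le_one hW)
  refine le_trans (ENNReal.tsum_le_tsum fun i => ?_)
    (ENNReal.tsum_add.trans_le (add_le_add (key S) (key T)))
  simp only [_root_.add_apply, map_add, inner_add_right]
  exact enorm_add_le _ _

theorem traceNorm_smul (c : ℂ) (T : E →L[ℂ] E) :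
    traceNorm (c • T) = ‖c‖ₑ * traceNorm T := by
  unfold traceNorm
  rw [CFC.abs_smul, ← ENNReal.tsum_mul_left]
  refine tsum_congr fun i => ?_
  rw [← ofReal_norm, ← ENNReal.ofReal_mul (norm_nonneg _), _root_.smul_apply,
    inner_smul_right_eq_smul]
  simp

theorem traceNorm_zero : traceNorm (0 : E →L[ℂ] E) = 0 := by
  simp [traceNorm]

theorem traceNorm_adjoint (T : E →L[ℂ] E) :
    traceNorm (ContinuousLinearMap.adjoint T) = traceNorm T := by
  have key : ∀ T : E →L[ℂ] E, traceNorm (ContinuousLinearMap.adjoint T) ≤ traceNorm T := by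
    intro T
    refine traceNorm_le fun W hW => ?_
    refine le_trans (ENNReal.tsum_le_tsum fun i => ?_)
      ((tsum_enorm_inner_le_traceNorm (T ∘L ContinuousLinearMap.adjoint W)).trans
        ((traceNorm_comp_le_right _ _).trans
          (mul_le_of_le_one_left' (enorm_le_one (by simpa using hW)))))
    rw [← ContinuousLinearMap.adjoint_inner_left, ContinuousLinearMap.adjoint_inner_right,
      ← inner_conj_symm, ContinuousLinearMap.comp_apply]
    exact (RCLike.enorm_conj _).le
  refine le_antisymm (key T) ?_
  simpa using key (ContinuousLinearMap.adjoint T)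

theorem traceNorm_adjoint_comp_le (A B : E →L[ℂ] F) :
    traceNorm ((ContinuousLinearMap.adjoint A) ∘L B) ≤
      (hsSq A) ^ (1 / 2 : ℝ) * (hsSq B) ^ (1 / 2 : ℝ) := by
  refine traceNorm_le fun W hW => ?_
  set Q := A ∘L ContinuousLinearMap.adjoint W
  have hQ : hsSq Q ≤ hsSq A := by
    refine (hsSq_comp_le_right _ _).trans (mul_le_of_le_one_left' ?_)
    exact pow_le_one' (enorm_le_one (by simpa using hW)) 2
  refine le_trans (ENNReal.tsum_le_tsum (g := fun i => ‖Q (onb E i)‖ₑ * ‖B (onb E i)‖ₑ)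
    fun i => ?_) ((tsum_mul_le _ _).trans ?_)
  · have : ⟪onb E i, W (((ContinuousLinearMap.adjoint A) ∘L B) (onb E i))⟫_ℂ =
        ⟪Q (onb E i), B (onb E i)⟫_ℂ := by
      simp only [Q, ContinuousLinearMap.comp_apply]
      rw [← ContinuousLinearMap.adjoint_inner_left, ContinuousLinearMap.adjoint_inner_right]
    rw [this, ← ofReal_norm, ← ofReal_norm (Q _), ← ofReal_norm (B _),
      ← ENNReal.ofReal_mul (norm_nonneg _)]
    exact ENNReal.ofReal_le_ofReal (norm_inner_le_norm _ _)
  · change (hsSq Q) ^ (1 / 2 : ℝ) * (hsSq B) ^ (1 / 2 : ℝ) ≤ _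
    gcongr

theorem enorm_sq_le_hsSq (T : E →L[ℂ] F) : ‖T‖ₑ ^ 2 ≤ hsSq T := by
  by_cases hT : hsSq T = ⊤
  · simp [hT]
  have h : ∀ x : E, ‖T x‖ₑ ^ 2 ≤ hsSq T * ‖x‖ₑ ^ 2 := by
    intro x
    rw [parseval (onb F), hsSq_eq_of_basis (onb F) T, ← ENNReal.tsum_mul_right]
    refine ENNReal.tsum_le_tsum fun j => ?_
    rw [← mul_pow, ← ContinuousLinearMap.adjoint_inner_left, ← ofReal_norm, ← ofReal_norm,
      ← ofReal_norm x, ← ENNReal.ofReal_mul (norm_nonneg _)]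
    gcongr
    exact norm_inner_le_norm _ _
  have h2 : ‖T‖ ≤ √(hsSq T).toReal := by
    refine T.opNorm_le_bound (Real.sqrt_nonneg _) fun x => ?_
    have h3 := ENNReal.toReal_mono (ENNReal.mul_ne_top hT (by simp)) (h x)
    rw [ENNReal.toReal_mul, ENNReal.toReal_pow, ENNReal.toReal_pow, toReal_enorm,
      toReal_enorm] at h3
    refine (sq_le_sq₀ (norm_nonneg _) (by positivity)).1 ?_
    rwa [mul_pow, Real.sq_sqrt ENNReal.toReal_nonneg]
  rw [← ofReal_norm, ← ENNReal.ofReal_pow (norm_nonneg _), ← ENNReal.ofReal_toReal hT]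
  refine ENNReal.ofReal_le_ofReal ?_
  calc ‖T‖ ^ 2 ≤ √(hsSq T).toReal ^ 2 := by gcongr
    _ = _ := Real.sq_sqrt ENNReal.toReal_nonneg

theorem enorm_le_traceNorm (T : E →L[ℂ] E) : ‖T‖ₑ ≤ traceNorm T := by
  have h0 : ‖T‖ ≤ ‖CFC.sqrt (CFC.abs T)‖ ^ 2 := by
    rw [← CFC.norm_abs (a := T)]
    conv_lhs => rw [← CFC.sqrt_mul_sqrt_self (CFC.abs T) (CFC.abs_nonneg T)]
    rw [sq]
    exact norm_mul_le _ _
  rw [traceNorm_eq_hsSq]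
  refine le_trans ?_ (enorm_sq_le_hsSq _)
  rw [← ofReal_norm, ← ofReal_norm, ← ENNReal.ofReal_pow (norm_nonneg _)]
  exact ENNReal.ofReal_le_ofReal h0

/-- The trace class operators on `E`: those with `Tr |T| < ∞`. -/
def traceClass (E : Type*) [NormedAddCommGroup E] [InnerProductSpace ℂ E] [CompleteSpace E] :
    Submodule ℂ (E →L[ℂ] E) where
  carrier := {T | traceNorm T < ⊤}
  add_mem' := fun hS hT => (traceNorm_add_le _ _).trans_lt (ENNReal.add_lt_top.2 ⟨hS, hT⟩)
  zero_mem' := by simp [traceNorm_zero]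
  smul_mem' := fun c T hT => by
    change traceNorm (c • T) < ⊤
    rw [traceNorm_smul]
    exact ENNReal.mul_lt_top (by simp) hT

/-- The Hilbert-Schmidt operators from `E` to `F`: those with `∑ ‖T eᵢ‖² < ∞`. -/
def hilbertSchmidt (E F : Type*) [NormedAddCommGroup E] [InnerProductSpace ℂ E] [CompleteSpace E]
    [NormedAddCommGroup F] [InnerProductSpace ℂ F] [CompleteSpace F] :
    Submodule ℂ (E →L[ℂ] F) where
  carrier := {T | hsSq T < ⊤}
  add_mem' := fun {S T} hS hT => by
    have h : hsSq (S + T) ≤ 2 * hsSq S + 2 * hsSq T := by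
      unfold hsSq
      rw [← ENNReal.tsum_mul_left, ← ENNReal.tsum_mul_left, ← ENNReal.tsum_add]
      refine ENNReal.tsum_le_tsum fun i => ?_
      have h1 : ‖S (onb E i) + T (onb E i)‖ ^ 2 ≤
          2 * ‖S (onb E i)‖ ^ 2 + 2 * ‖T (onb E i)‖ ^ 2 := by
        nlinarith [norm_add_le (S (onb E i)) (T (onb E i)),
          sq_nonneg (‖S (onb E i)‖ - ‖T (onb E i)‖), norm_nonneg (S (onb E i) + T (onb E i))]
      have h2 := ENNReal.ofReal_le_ofReal h1
      rw [ENNReal.ofReal_add (by positivity) (by positivity), ENNReal.ofReal_mul (by positivity),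
        ENNReal.ofReal_mul (by positivity), ENNReal.ofReal_pow (by positivity),
        ENNReal.ofReal_pow (by positivity), ENNReal.ofReal_pow (by positivity), ofReal_norm,
        ofReal_norm, ofReal_norm] at h2
      simpa using h2
    exact h.trans_lt (ENNReal.add_lt_top.2
      ⟨ENNReal.mul_lt_top (by simp) hS, ENNReal.mul_lt_top (by simp) hT⟩)
  zero_mem' := by simp [hsSq]
  smul_mem' := fun c T hT => by
    have h : hsSq (c • T) = ‖c‖ₑ ^ 2 * hsSq T := by
      unfold hsSq
      rw [← ENNReal.tsum_mul_left]
      refine tsum_congr fun i => ?_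
      rw [_root_.smul_apply, enorm_smul, mul_pow]
    change hsSq (c • T) < ⊤
    rw [h]
    exact ENNReal.mul_lt_top (by simp) hT

/-- The Banach space `L¹(E)` of trace class operators on `E`, with the norm `Tr |T|`. -/
def L1 (E : Type*) [NormedAddCommGroup E] [InnerProductSpace ℂ E] [CompleteSpace E] : Type _ :=
  traceClass E

/-- The space `L²(E, F)` of Hilbert-Schmidt operators, with the norm `(∑ ‖T eᵢ‖²)^{1/2}`. -/
def L2 (E F : Type*) [NormedAddCommGroup E] [InnerProductSpace ℂ E] [CompleteSpace E]
    [NormedAddCommGroup F] [InnerProductSpace ℂ F] [CompleteSpace F] : Type _ :=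
  hilbertSchmidt E F

namespace L1

instance : AddCommGroup (L1 E) := inferInstanceAs (AddCommGroup (traceClass E))
instance : Module ℂ (L1 E) := inferInstanceAs (Module ℂ (traceClass E))

/-- The underlying bounded operator. -/
def op : L1 E →ₗ[ℂ] (E →L[ℂ] E) := (traceClass E).subtype

/-- A bounded operator with finite trace norm, as an element of `L¹(E)`. -/
def mk (T : E →L[ℂ] E) (hT : traceNorm T < ⊤) : L1 E := ⟨T, hT⟩

@[simp] theorem op_mk (T : E →L[ℂ] E) (hT : traceNorm T < ⊤) : op (mk T hT) = T := rfl

theorem op_injective : Function.Injective (op : L1 E → E →L[ℂ] E) := Subtype.val_injective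

@[ext] theorem ext {S T : L1 E} (h : op S = op T) : S = T := op_injective h

theorem traceNorm_lt_top (T : L1 E) : traceNorm (op T) < ⊤ := T.2

instance : Norm (L1 E) := ⟨fun T => (traceNorm (op T)).toReal⟩

theorem norm_def (T : L1 E) : ‖T‖ = (traceNorm (op T)).toReal := rfl

theorem norm_op_le (T : L1 E) : ‖op T‖ ≤ ‖T‖ := by
  have := ENNReal.toReal_mono T.traceNorm_lt_top.ne (enorm_le_traceNorm (op T))
  rwa [toReal_enorm] at this

theorem core : NormedSpace.Core ℂ (L1 E) where
  norm_nonneg _ := ENNReal.toReal_nonneg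
  norm_smul c T := by
    simp [norm_def, traceNorm_smul]
  norm_triangle S T := by
    rw [norm_def, norm_def, norm_def, map_add,
      ← ENNReal.toReal_add S.traceNorm_lt_top.ne T.traceNorm_lt_top.ne]
    exact ENNReal.toReal_mono (ENNReal.add_ne_top.2
      ⟨S.traceNorm_lt_top.ne, T.traceNorm_lt_top.ne⟩) (traceNorm_add_le _ _)
  norm_eq_zero_iff T := by
    refine ⟨fun h => ext ?_, fun h => by simp [h, norm_def, traceNorm_zero]⟩
    have := norm_op_le T
    rw [h] at this
    rw [map_zero]
    exact norm_le_zero_iff.1 this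

instance : NormedAddCommGroup (L1 E) := NormedAddCommGroup.ofCore core
instance : NormedSpace ℂ (L1 E) := NormedSpace.ofCore core

end L1

namespace L2

instance : AddCommGroup (L2 E F) := inferInstanceAs (AddCommGroup (hilbertSchmidt E F))
instance : Module ℂ (L2 E F) := inferInstanceAs (Module ℂ (hilbertSchmidt E F))

/-- The underlying bounded operator. -/
def op : L2 E F →ₗ[ℂ] (E →L[ℂ] F) := (hilbertSchmidt E F).subtype

/-- A bounded operator with `∑ ‖T eᵢ‖² < ∞`, as an element of `L²(E, F)`. -/
def mk (T : E →L[ℂ] F) (hT : hsSq T < ⊤) : L2 E F := ⟨T, hT⟩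

@[simp] theorem op_mk (T : E →L[ℂ] F) (hT : hsSq T < ⊤) : op (mk T hT) = T := rfl

theorem op_injective : Function.Injective (op : L2 E F → E →L[ℂ] F) := Subtype.val_injective

@[ext] theorem ext {S T : L2 E F} (h : op S = op T) : S = T := op_injective h

theorem hsSq_lt_top (T : L2 E F) : hsSq (op T) < ⊤ := T.2

instance : Norm (L2 E F) := ⟨fun T => √(hsSq (op T)).toReal⟩

theorem norm_def (T : L2 E F) : ‖T‖ = √(hsSq (op T)).toReal := rfl

theorem norm_op_le (T : L2 E F) : ‖op T‖ ≤ ‖T‖ := by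
  have := ENNReal.toReal_mono T.hsSq_lt_top.ne (enorm_sq_le_hsSq (op T))
  rw [ENNReal.toReal_pow, toReal_enorm] at this
  exact Real.le_sqrt_of_sq_le this

theorem memℓp (T : L2 E F) : Memℓp (fun i : BasisIndex E => op T (onb E i)) 2 := by
  refine memℓp_gen ?_
  have h := T.hsSq_lt_top.ne
  unfold hsSq at h
  have h2 := ENNReal.summable_toReal h
  refine h2.congr fun i => ?_
  simp

/-- The family `(T eᵢ)` as a square summable family. -/
def toLp : L2 E F →ₗ[ℂ] lp (fun _ : BasisIndex E => F) 2 where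
  toFun T := ⟨fun i => op T (onb E i), T.memℓp⟩
  map_add' S T := by ext i; simp; rfl
  map_smul' c T := by ext i; simp

theorem norm_toLp (T : L2 E F) : ‖toLp T‖ = ‖T‖ := by
  rw [lp.norm_eq_tsum_rpow (by norm_num), norm_def, Real.sqrt_eq_rpow]
  unfold hsSq
  rw [ENNReal.tsum_toReal_eq (fun i => by simp)]
  simp [toLp]

theorem core : NormedSpace.Core ℂ (L2 E F) where
  norm_nonneg _ := Real.sqrt_nonneg _
  norm_smul c T := by
    rw [← norm_toLp, ← norm_toLp, map_smul, norm_smul]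
  norm_triangle S T := by
    rw [← norm_toLp, ← norm_toLp, ← norm_toLp, map_add]
    exact norm_add_le _ _
  norm_eq_zero_iff T := by
    refine ⟨fun h => ext ?_, fun h => by rw [← norm_toLp, h, map_zero, norm_zero]⟩
    have := norm_op_le T
    rw [h] at this
    rw [map_zero]
    exact norm_le_zero_iff.1 this

instance : NormedAddCommGroup (L2 E F) := NormedAddCommGroup.ofCore core
instance : NormedSpace ℂ (L2 E F) := NormedSpace.ofCore core

end L2

/-- The trace `∑ ⟪eᵢ, T eᵢ⟫`. -/
def trace (T : E →L[ℂ] E) : ℂ := ∑' i, ⟪onb E i, T (onb E i)⟫_ℂ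

theorem summable_trace {T : E →L[ℂ] E} (hT : traceNorm T < ⊤) :
    Summable fun i => ⟪onb E i, T (onb E i)⟫_ℂ := by
  have h := ((tsum_enorm_inner_le_traceNorm T).trans_lt hT).ne
  refine Summable.of_norm ?_
  simpa using ENNReal.summable_toReal h

theorem trace_add {S T : E →L[ℂ] E} (hS : traceNorm S < ⊤) (hT : traceNorm T < ⊤) :
    trace (S + T) = trace S + trace T := by
  unfold trace
  rw [← (summable_trace hS).tsum_add (summable_trace hT)]
  simp

theorem trace_smul (c : ℂ) (T : E →L[ℂ] E) : trace (c • T) = c * trace T := by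
  unfold trace
  rw [← tsum_mul_left]
  simp

theorem norm_trace_le {T : E →L[ℂ] E} (hT : traceNorm T < ⊤) :
    ‖trace T‖ ≤ (traceNorm T).toReal := by
  have h1 := tsum_enorm_inner_le_traceNorm T
  have h := (h1.trans_lt hT).ne
  refine (norm_tsum_le_tsum_norm (summable_trace hT).norm).trans ?_
  refine le_trans (le_of_eq ?_) (ENNReal.toReal_mono hT.ne h1)
  rw [ENNReal.tsum_toReal_eq (fun i => by simp)]
  simp

end Schatten
end HilbertIdeal

namespace BanachSubmanifold

section

variable {V : Type*} [NormedAddCommGroup V] [NormedSpace ℝ V]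
  {M : Type*} [TopologicalSpace M] [ChartedSpace V M]

/-- A smooth chart `φ` of the Banach manifold `M` adapted to the subset `S`: it straightens `S` to
the closed, complemented subspace `A` of the model space. -/
structure IsAdaptedChart (S : Set M) (A : Submodule ℝ V) (φ : OpenPartialHomeomorph M V) :
    Prop where
  mem_maximalAtlas : φ ∈ IsManifold.maximalAtlas 𝓘(ℝ, V) ∞ M
  complemented : A.ClosedComplemented
  image_eq : φ '' (φ.source ∩ S) = φ.target ∩ (A : Set V)

/-- `S` is a smooth (split) submanifold of the Banach manifold `M`: it is covered by
adapted charts. -/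
def IsSmoothSubmanifold (S : Set M) : Prop :=
  ∀ p ∈ S, ∃ (A : Submodule ℝ V) (φ : OpenPartialHomeomorph M V),
    IsAdaptedChart S A φ ∧ p ∈ φ.source

/-- The expression, in the chart of `S` given by the adapted chart `φ`, of the restriction to the
tangent spaces of `S` of a field `g` of bilinear forms on the tangent spaces of `M`:
`g(dψ u, dψ v)` for the local parametrization `ψ = φ⁻¹` and `u, v ∈ A`. -/
def inducedForm (g : ∀ p : M, TangentSpace 𝓘(ℝ, V) p →L[ℝ] TangentSpace 𝓘(ℝ, V) p →L[ℝ] ℝ)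
    (A : Submodule ℝ V) (φ : OpenPartialHomeomorph M V) (y : A) : A →L[ℝ] A →L[ℝ] ℝ :=
  let D : A →L[ℝ] V := (mfderiv 𝓘(ℝ, V) 𝓘(ℝ, V) φ.symm (y : V) : V →L[ℝ] V) ∘L A.subtypeL
  let b : V →L[ℝ] V →L[ℝ] ℝ := g (φ.symm y)
  b.bilinearComp D D

/-- `S` is a smooth submanifold of `M` and `g` restricts to a (weak) Riemannian metric on `S`:
in every chart of `S` coming from an adapted chart, the restricted form depends smoothly on the
point and is symmetric and positive definite. -/
def IsRiemannianSubmanifold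
    (g : ∀ p : M, TangentSpace 𝓘(ℝ, V) p →L[ℝ] TangentSpace 𝓘(ℝ, V) p →L[ℝ] ℝ)
    (S : Set M) : Prop :=
  IsSmoothSubmanifold (V := V) S ∧
  ∀ (A : Submodule ℝ V) (φ : OpenPartialHomeomorph M V), IsAdaptedChart S A φ →
    ContDiffOn ℝ ∞ (inducedForm g A φ) {y : A | (y : V) ∈ φ.target} ∧
    ∀ y : A, (y : V) ∈ φ.target →
      (∀ u v : A, inducedForm g A φ y u v = inducedForm g A φ y v u) ∧
      (∀ u : A, u ≠ 0 → 0 < inducedForm g A φ y u u)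

end

/-- The orthogonal of a subspace with respect to a continuous bilinear form. -/
def formOrthogonal {V : Type*} [AddCommGroup V] [Module ℝ V] [TopologicalSpace V]
    (b : V →L[ℝ] V →L[ℝ] ℝ) (K : Submodule ℝ V) : Submodule ℝ V where
  carrier := {v | ∀ w ∈ K, b w v = 0}
  add_mem' := fun hu hv w hw => by rw [map_add, hu w hw, hv w hw, add_zero]
  zero_mem' := fun w _ => map_zero _
  smul_mem' := fun c v hv w hw => by rw [map_smul, hv w hw, smul_zero]

end BanachSubmanifold

namespace HyperkahlerGrassmannian

open HilbertIdeal

section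

variable {H : Type*} [NormedAddCommGroup H] [InnerProductSpace ℂ H] [CompleteSpace H]
  (Hp : Submodule ℂ H) [CompleteSpace Hp]

/-- The orthogonal projection `p₊ : H → H₊`. -/
abbrev pPlus : H →L[ℂ] Hp := Hp.orthogonalProjectionOnto

/-- The orthogonal projection `p₋ : H → H₋`, where `H₋` is the orthogonal complement of `H₊`. -/
abbrev pMinus : H →L[ℂ] Hpᗮ := Hpᗮ.orthogonalProjectionOnto

/-- The Banach space `L¹(H₊) × L²(H₊, H₋)`. -/
abbrev Model : Type _ := L1 Hp × L2 Hp Hpᗮ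

/-- The affine Banach space `M_k` of all `x ∈ B(H₊, H)` such that `p₊ x - k Id` is of trace class
and `p₋ x` is Hilbert-Schmidt. -/
def baseSpace (k : ℝ) : Set (Hp →L[ℂ] H) :=
  {x | traceNorm (pPlus Hp ∘L x - (k : ℂ) • ContinuousLinearMap.id ℂ Hp) < ⊤ ∧
    hsSq (pMinus Hp ∘L x) < ⊤}

/-- The tangent space of `M_k` at each of its points, as a set of operators. -/
def tangentOps : Set (Hp →L[ℂ] H) :=
  {X | traceNorm (pPlus Hp ∘L X) < ⊤ ∧ hsSq (pMinus Hp ∘L X) < ⊤}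

/-- The tangent bundle `TM_k`, the set of pairs `(x, X)`. -/
def TM (k : ℝ) : Type _ :=
  {p : (Hp →L[ℂ] H) × (Hp →L[ℂ] H) // p.1 ∈ baseSpace Hp k ∧ p.2 ∈ tangentOps Hp}

variable {Hp}

/-- The operator `H₊ → H` with given components in `H₊` and `H₋`. -/
def opOf (Z : Model Hp) : Hp →L[ℂ] H :=
  Hp.subtypeL ∘L L1.op Z.1 + Hpᗮ.subtypeL ∘L L2.op Z.2

theorem decomp (x : Hp →L[ℂ] H) :
    Hp.subtypeL ∘L (pPlus Hp ∘L x) + Hpᗮ.subtypeL ∘L (pMinus Hp ∘L x) = x := by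
  ext v
  simp

theorem pPlus_add (a : Hp →L[ℂ] Hp) (b : Hp →L[ℂ] Hpᗮ) :
    pPlus Hp ∘L (Hp.subtypeL ∘L a + Hpᗮ.subtypeL ∘L b) = a := by
  ext v
  have h : Hp.orthogonalProjectionOnto (b v : H) = 0 :=
    Submodule.orthogonalProjectionOnto_apply_of_mem_orthogonal (b v).2
  simp [h]

theorem pMinus_add (a : Hp →L[ℂ] Hp) (b : Hp →L[ℂ] Hpᗮ) :
    pMinus Hp ∘L (Hp.subtypeL ∘L a + Hpᗮ.subtypeL ∘L b) = b := by
  ext v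
  simp

/-- The global affine chart of `TM_k` with values in `(L¹(H₊) × L²(H₊, H₋))²`:
`(x, X) ↦ ((p₊ x - k Id, p₋ x), (p₊ X, p₋ X))`. -/
def coords (k : ℝ) : TM Hp k ≃ Model Hp × Model Hp where
  toFun p := ((L1.mk _ p.2.1.1, L2.mk _ p.2.1.2), (L1.mk _ p.2.2.1, L2.mk _ p.2.2.2))
  invFun z := ⟨((k : ℂ) • Hp.subtypeL + opOf z.1, opOf z.2), by
    have h : (k : ℂ) • Hp.subtypeL + opOf z.1 =
        Hp.subtypeL ∘L ((k : ℂ) • ContinuousLinearMap.id ℂ Hp + L1.op z.1.1) +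
          Hpᗮ.subtypeL ∘L L2.op z.1.2 := by
      ext v; simp [opOf, add_assoc]
    refine ⟨?_, ?_⟩
    · rw [h]
      refine ⟨?_, ?_⟩
      · rw [pPlus_add, add_sub_cancel_left]
        exact z.1.1.traceNorm_lt_top
      · rw [pMinus_add]
        exact z.1.2.hsSq_lt_top
    · refine ⟨?_, ?_⟩
      · simp only [opOf, pPlus_add]
        exact z.2.1.traceNorm_lt_top
      · simp only [opOf, pMinus_add]
        exact z.2.2.hsSq_lt_top⟩
  left_inv p := by
    refine Subtype.ext (Prod.ext ?_ ?_)
    · refine Eq.trans ?_ (decomp p.1.1)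
      ext v
      simp [opOf]
    · exact decomp p.1.2
  right_inv z := by
    have h : (k : ℂ) • Hp.subtypeL + opOf z.1 =
        Hp.subtypeL ∘L ((k : ℂ) • ContinuousLinearMap.id ℂ Hp + L1.op z.1.1) +
          Hpᗮ.subtypeL ∘L L2.op z.1.2 := by
      ext v; simp [opOf, add_assoc]
    refine Prod.ext (Prod.ext ?_ ?_) (Prod.ext ?_ ?_)
    · refine L1.ext ?_
      simp only [L1.op_mk]
      rw [h, pPlus_add, add_sub_cancel_left]
    · refine L2.ext ?_
      simp only [L2.op_mk]
      rw [h, pMinus_add]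
    · exact L1.ext (pPlus_add _ _)
    · exact L2.ext (pMinus_add _ _)

instance (k : ℝ) : TopologicalSpace (TM Hp k) := TopologicalSpace.induced (coords k) inferInstance

/-- The global affine chart as a homeomorphism. -/
def coordsHomeo (k : ℝ) : TM Hp k ≃ₜ Model Hp × Model Hp :=
  (coords k).toHomeomorphOfIsInducing ⟨rfl⟩

/-- `TM_k` is a Banach manifold with a single (affine) chart. -/
instance (k : ℝ) : ChartedSpace (Model Hp × Model Hp) (TM Hp k) :=
  (coordsHomeo k).toOpenPartialHomeomorph.singletonChartedSpace rfl

instance (k : ℝ) : IsManifold 𝓘(ℝ, Model Hp × Model Hp) ∞ (TM Hp k) :=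
  (coordsHomeo k).toOpenPartialHomeomorph.isManifold_singleton rfl

local notation "adj" => ContinuousLinearMap.adjoint

theorem adjoint_comp_eq (A B : Hp →L[ℂ] H) :
    adj A ∘L B = adj (pPlus Hp ∘L A) ∘L (pPlus Hp ∘L B) +
      adj (pMinus Hp ∘L A) ∘L (pMinus Hp ∘L B) := by
  ext1 v
  refine ext_inner_left ℂ fun w => ?_
  rw [_root_.add_apply, inner_add_right]
  simp only [ContinuousLinearMap.comp_apply, ContinuousLinearMap.adjoint_inner_right]
  have h := Hp.starProjection_add_starProjection_orthogonal
  conv_lhs => rw [← h (A w), ← h (B v)]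
  have h1 := Submodule.inner_right_of_mem_orthogonal (Hp.starProjection_apply_mem (A w))
    (Hpᗮ.starProjection_apply_mem (B v))
  have h2 := Submodule.inner_left_of_mem_orthogonal (Hp.starProjection_apply_mem (B v))
    (Hpᗮ.starProjection_apply_mem (A w))
  rw [inner_add_left, inner_add_right, inner_add_right, h1, h2, add_zero, zero_add]
  rfl

theorem op_real_smul {E : Type*} [NormedAddCommGroup E] [InnerProductSpace ℂ E] [CompleteSpace E]
    (c : ℝ) (T : L1 E) : L1.op (c • T) = (c : ℂ) • L1.op T :=
  L1.op.map_smul (c : ℂ) T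

/-- Self-adjoint trace class operators, a real Banach space. -/
def S1 (E : Type*) [NormedAddCommGroup E] [InnerProductSpace ℂ E] [CompleteSpace E] :
    Submodule ℝ (L1 E) where
  carrier := {T | adj (L1.op T) = L1.op T}
  add_mem' := fun {S T} hS hT => by
    simp only [mem_ofPred_eq, map_add] at *; rw [hS, hT]
  zero_mem' := by simp
  smul_mem' := fun c T hT => by
    simp only [mem_ofPred_eq, op_real_smul, map_smulₛₗ, Complex.conj_ofReal] at *; rw [hT]

/-- Skew-Hermitian trace class operators: the Lie algebra `𝔤` of `G`, a real Banach space. -/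
def A1 (E : Type*) [NormedAddCommGroup E] [InnerProductSpace ℂ E] [CompleteSpace E] :
    Submodule ℝ (L1 E) where
  carrier := {T | adj (L1.op T) = - L1.op T}
  add_mem' := fun {S T} hS hT => by
    simp only [mem_ofPred_eq, map_add] at *; rw [hS, hT, neg_add]
  zero_mem' := by simp
  smul_mem' := fun c T hT => by
    simp only [mem_ofPred_eq, op_real_smul, map_smulₛₗ, Complex.conj_ofReal] at *
    rw [hT, smul_neg]

/-! ### Trace class estimates -/

theorem enorm_lt_top' {E F : Type*} [NormedAddCommGroup E] [InnerProductSpace ℂ E]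
    [NormedAddCommGroup F] [InnerProductSpace ℂ F] (T : E →L[ℂ] F) : ‖T‖ₑ < ⊤ := by simp

/-- If `A` is bounded and `B` is tangent to `M_k`, and the `H₋`-component of `A` is
Hilbert-Schmidt, then `A* B` is of trace class. -/
theorem traceNorm_adjoint_comp_lt_top {A B : Hp →L[ℂ] H} (hA : hsSq (pMinus Hp ∘L A) < ⊤)
    (hB : B ∈ tangentOps Hp) : traceNorm (adj A ∘L B) < ⊤ := by
  rw [adjoint_comp_eq]
  refine (traceNorm_add_le _ _).trans_lt (ENNReal.add_lt_top.2 ⟨?_, ?_⟩)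
  · exact (traceNorm_comp_le_left _ _).trans_lt (ENNReal.mul_lt_top (enorm_lt_top' _) hB.1)
  · refine (traceNorm_adjoint_comp_le _ _).trans_lt (ENNReal.mul_lt_top ?_ ?_)
    · exact ENNReal.rpow_lt_top_of_nonneg (by norm_num) hA.ne
    · exact ENNReal.rpow_lt_top_of_nonneg (by norm_num) hB.2.ne

theorem traceNorm_moment_lt_top {k : ℝ} (p : TM Hp k) :
    traceNorm (adj p.1.2 ∘L p.1.1) < ⊤ := by
  rw [← traceNorm_adjoint, ContinuousLinearMap.adjoint_comp, ContinuousLinearMap.adjoint_adjoint]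
  exact traceNorm_adjoint_comp_lt_top p.2.1.2 p.2.2

theorem traceNorm_real_moment_lt_top {k : ℝ} (p : TM Hp k) :
    traceNorm (adj p.1.1 ∘L p.1.1 - adj p.1.2 ∘L p.1.2 -
      ((k ^ 2 : ℝ) : ℂ) • ContinuousLinearMap.id ℂ Hp) < ⊤ := by
  set x := p.1.1
  set y := x - (k : ℂ) • Hp.subtypeL with hy
  have hyT : y ∈ tangentOps Hp := by
    refine ⟨?_, ?_⟩
    · convert p.2.1.1 using 2
      ext v; simp [hy, x]
    · convert p.2.1.2 using 2
      ext v; simp [hy, x]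
  have hid : adj Hp.subtypeL ∘L Hp.subtypeL = ContinuousLinearMap.id ℂ Hp := by
    ext1 v
    refine ext_inner_left ℂ fun w => ?_
    rw [ContinuousLinearMap.comp_apply, ContinuousLinearMap.adjoint_inner_right]
    rfl
  have hx : x = y + (k : ℂ) • Hp.subtypeL := by simp [hy]
  have hι : hsSq (pMinus Hp ∘L ((k : ℂ) • Hp.subtypeL)) < ⊤ := by
    have : pMinus Hp ∘L ((k : ℂ) • Hp.subtypeL) = 0 := by
      ext v; simp
    rw [this]; simp [hsSq]
  have e : adj x ∘L x - adj p.1.2 ∘L p.1.2 - ((k ^ 2 : ℝ) : ℂ) • ContinuousLinearMap.id ℂ Hp =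
      adj x ∘L y + adj (adj ((k : ℂ) • Hp.subtypeL) ∘L y) +
        (-1 : ℂ) • (adj p.1.2 ∘L p.1.2) := by
    rw [ContinuousLinearMap.adjoint_comp, ContinuousLinearMap.adjoint_adjoint]
    have : adj x ∘L x = adj x ∘L y + adj y ∘L ((k : ℂ) • Hp.subtypeL) +
        ((k ^ 2 : ℝ) : ℂ) • ContinuousLinearMap.id ℂ Hp := by
      have hka : adj ((k : ℂ) • Hp.subtypeL) = (k : ℂ) • adj Hp.subtypeL := by
        rw [map_smulₛₗ, Complex.conj_ofReal]
      have hk2 : adj ((k : ℂ) • Hp.subtypeL) ∘L ((k : ℂ) • Hp.subtypeL) =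
          ((k ^ 2 : ℝ) : ℂ) • ContinuousLinearMap.id ℂ Hp := by
        rw [hka, ContinuousLinearMap.smul_comp, ContinuousLinearMap.comp_smul, hid, smul_smul,
          ← sq, Complex.ofReal_pow]
      rw [← hk2]
      conv_lhs => enter [2]; rw [hx]
      conv_lhs => rw [ContinuousLinearMap.comp_add]
      conv_lhs => enter [2]; rw [hx]
      rw [map_add, ContinuousLinearMap.add_comp, add_assoc]
    rw [this]
    ext1 v
    simp
    abel
  rw [e]
  refine (traceNorm_add_le _ _).trans_lt (ENNReal.add_lt_top.2 ⟨?_, ?_⟩)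
  · refine (traceNorm_add_le _ _).trans_lt (ENNReal.add_lt_top.2 ⟨?_, ?_⟩)
    · exact traceNorm_adjoint_comp_lt_top p.2.1.2 hyT
    · rw [traceNorm_adjoint]
      exact traceNorm_adjoint_comp_lt_top hι hyT
  · rw [traceNorm_smul]
    exact ENNReal.mul_lt_top (by simp) (traceNorm_adjoint_comp_lt_top p.2.2.2 p.2.2)

variable (Hp) in
/-- The map `(x, X) ↦ (X* x, x* x - X* X)` from `TM_k` to `L¹(H₊) × (k² Id + S¹(H₊))`. The second
factor is an affine space, identified with its direction `S¹(H₊)` by subtracting `k² Id`. -/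
def levelMap (k : ℝ) (p : TM Hp k) : L1 Hp × S1 Hp :=
  (L1.mk (adj p.1.2 ∘L p.1.1) (traceNorm_moment_lt_top p),
    ⟨L1.mk (adj p.1.1 ∘L p.1.1 - adj p.1.2 ∘L p.1.2 -
      ((k ^ 2 : ℝ) : ℂ) • ContinuousLinearMap.id ℂ Hp) (traceNorm_real_moment_lt_top p), by
      change adj _ = _
      rw [L1.op_mk, map_sub, map_sub, ContinuousLinearMap.adjoint_comp,
        ContinuousLinearMap.adjoint_comp, ContinuousLinearMap.adjoint_adjoint,
        ContinuousLinearMap.adjoint_adjoint, map_smulₛₗ, Complex.conj_ofReal]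
      congr 2
      exact ContinuousLinearMap.adjoint_id⟩)

/-! ### The weak Riemannian metric -/

theorem opOf_mem (Z : Model Hp) : opOf Z ∈ tangentOps Hp :=
  ⟨by rw [opOf, pPlus_add]; exact Z.1.traceNorm_lt_top,
    by rw [opOf, pMinus_add]; exact Z.2.hsSq_lt_top⟩

theorem traceNorm_opOf_lt_top (Z W : Model Hp) : traceNorm (adj (opOf Z) ∘L opOf W) < ⊤ :=
  traceNorm_adjoint_comp_lt_top (opOf_mem Z).2 (opOf_mem W)

theorem traceNorm_opOf_le (Z W : Model Hp) :
    (traceNorm (adj (opOf Z) ∘L opOf W)).toReal ≤ 2 * ‖Z‖ * ‖W‖ := by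
  have h1 : traceNorm (adj (opOf Z) ∘L opOf W) ≤ ‖L1.op Z.1‖ₑ * traceNorm (L1.op W.1) +
      hsSq (L2.op Z.2) ^ (1 / 2 : ℝ) * hsSq (L2.op W.2) ^ (1 / 2 : ℝ) := by
    rw [adjoint_comp_eq, opOf, opOf, pPlus_add, pMinus_add, pPlus_add, pMinus_add]
    refine (traceNorm_add_le _ _).trans (add_le_add ?_ (traceNorm_adjoint_comp_le _ _))
    refine (traceNorm_comp_le_left _ _).trans_eq ?_
    simp [← ofReal_norm]
  have h2 : ∀ T : L2 Hp Hpᗮ, (hsSq (L2.op T) ^ (1 / 2 : ℝ)).toReal = ‖T‖ := fun T => by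
    rw [← ENNReal.toReal_rpow, L2.norm_def, Real.sqrt_eq_rpow]
  have h3 : ∀ T : L2 Hp Hpᗮ, hsSq (L2.op T) ^ (1 / 2 : ℝ) ≠ ⊤ := fun T =>
    (ENNReal.rpow_lt_top_of_nonneg (by norm_num) T.hsSq_lt_top.ne).ne
  have h4 := ENNReal.toReal_mono (ENNReal.add_ne_top.2
    ⟨ENNReal.mul_ne_top (enorm_lt_top' _).ne W.1.traceNorm_lt_top.ne,
      ENNReal.mul_ne_top (h3 Z.2) (h3 W.2)⟩) h1
  rw [ENNReal.toReal_add (ENNReal.mul_ne_top (enorm_lt_top' _).ne W.1.traceNorm_lt_top.ne)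
    (ENNReal.mul_ne_top (h3 Z.2) (h3 W.2)), ENNReal.toReal_mul, ENNReal.toReal_mul, h2, h2,
    toReal_enorm, ← L1.norm_def] at h4
  have h5 : ‖L1.op Z.1‖ ≤ ‖Z‖ := (L1.norm_op_le _).trans (norm_fst_le Z)
  have h6 : ‖L1.op Z.1‖ * ‖W.1‖ ≤ ‖Z‖ * ‖W‖ := by
    gcongr; exact norm_fst_le W
  have h7 : ‖Z.2‖ * ‖W.2‖ ≤ ‖Z‖ * ‖W‖ := by
    gcongr
    · exact norm_snd_le Z
    · exact norm_snd_le W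
  linarith

theorem opOf_add (Z W : Model Hp) : opOf (Z + W) = opOf Z + opOf W := by
  ext v; simp [opOf]; abel

theorem opOf_real_smul (c : ℝ) (Z : Model Hp) : opOf (c • Z) = (c : ℂ) • opOf Z := by
  have h1 : L1.op (c • Z).1 = (c : ℂ) • L1.op Z.1 := op_real_smul c Z.1
  have h2 : L2.op (c • Z).2 = (c : ℂ) • L2.op Z.2 := L2.op.map_smul (c : ℂ) Z.2
  ext v
  simp [opOf, h1, h2]

variable (Hp) in
/-- The form `(Z, W) ↦ Re Tr (Z* W)`. -/
def reTraceForm : Model Hp →L[ℝ] Model Hp →L[ℝ] ℝ :=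
  LinearMap.mkContinuous₂
    (LinearMap.mk₂ ℝ (fun Z W : Model Hp => (trace (adj (opOf Z) ∘L opOf W)).re)
      (fun Z Z' W => by
        rw [opOf_add, map_add, ContinuousLinearMap.add_comp,
          trace_add (traceNorm_opOf_lt_top _ _) (traceNorm_opOf_lt_top _ _), Complex.add_re])
      (fun c Z W => by
        rw [opOf_real_smul, map_smulₛₗ, Complex.conj_ofReal, ContinuousLinearMap.smul_comp,
          trace_smul, Complex.re_ofReal_mul, smul_eq_mul])
      (fun Z W W' => by
        rw [opOf_add, ContinuousLinearMap.comp_add,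
          trace_add (traceNorm_opOf_lt_top _ _) (traceNorm_opOf_lt_top _ _), Complex.add_re])
      (fun c Z W => by
        rw [opOf_real_smul, ContinuousLinearMap.comp_smul,
          trace_smul, Complex.re_ofReal_mul, smul_eq_mul])) 2
    (fun Z W => by
      refine le_trans ?_ (traceNorm_opOf_le Z W)
      refine le_trans ?_ (norm_trace_le (traceNorm_opOf_lt_top Z W))
      exact Complex.abs_re_le_norm _)

variable (Hp) in
/-- The weak Riemannian metric
`g((Z₁, T₁), (Z₂, T₂)) = Re Tr (Z₁* Z₂) + Re Tr (T₁* T₂)` on `TM_k`. -/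
def metric (k : ℝ) (p : TM Hp k) :
    TangentSpace 𝓘(ℝ, Model Hp × Model Hp) p →L[ℝ]
      TangentSpace 𝓘(ℝ, Model Hp × Model Hp) p →L[ℝ] ℝ :=
  let f : Model Hp × Model Hp →L[ℝ] Model Hp := ContinuousLinearMap.fst ℝ _ _
  let s : Model Hp × Model Hp →L[ℝ] Model Hp := ContinuousLinearMap.snd ℝ _ _
  ((reTraceForm Hp).bilinearComp f f + (reTraceForm Hp).bilinearComp s s :
    (Model Hp × Model Hp) →L[ℝ] (Model Hp × Model Hp) →L[ℝ] ℝ)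

/-! ### The moment map -/

/-- The continuous functional `𝔞 ↦ Re (c Tr (B 𝔞))` on the Lie algebra `𝔤`. -/
def traceFunctional (c : ℂ) (B : Hp →L[ℂ] Hp) : A1 Hp →L[ℝ] ℝ :=
  LinearMap.mkContinuous
    { toFun := fun a => (c * trace (B ∘L L1.op a.1)).re
      map_add' := fun a a' => by
        have h : ∀ a : A1 Hp, traceNorm (B ∘L L1.op a.1) < ⊤ := fun a =>
          (traceNorm_comp_le_left _ _).trans_lt
            (ENNReal.mul_lt_top (enorm_lt_top' _) a.1.traceNorm_lt_top)
        rw [Submodule.coe_add, map_add, ContinuousLinearMap.comp_add, trace_add (h a) (h a'),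
          mul_add, Complex.add_re]
      map_smul' := fun r a => by
        rw [Submodule.coe_smul, op_real_smul, ContinuousLinearMap.comp_smul, trace_smul,
          mul_left_comm, Complex.re_ofReal_mul]
        rfl }
    (‖c‖ * ‖B‖) (fun a => by
      have h0 := traceNorm_comp_le_left B (L1.op a.1)
      have h1 := ENNReal.mul_lt_top (enorm_lt_top' B) a.1.traceNorm_lt_top
      have h2 := ENNReal.toReal_mono h1.ne h0
      rw [ENNReal.toReal_mul, toReal_enorm, ← L1.norm_def] at h2
      refine (Complex.abs_re_le_norm _).trans ?_
      rw [norm_mul, mul_assoc]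
      gcongr
      exact (norm_trace_le (h0.trans_lt h1)).trans h2)

variable (Hp) in
/-- The moment map `μ = (μ₁, μ₂, μ₃) : TM_k → 𝔤' × 𝔤' × 𝔤'`, where
`μ₁(x, X)(𝔞) = -(i/2) Tr ((x* x - X* X) 𝔞)`, `μ₂(x, X)(𝔞) = (1/2) Tr ((X* x - x* X) 𝔞)` and
`μ₃(x, X)(𝔞) = -(i/2) Tr ((X* x + x* X) 𝔞)`; these numbers are real for `𝔞 ∈ 𝔤`. -/
def momentMap (k : ℝ) (p : TM Hp k) : (A1 Hp →L[ℝ] ℝ) × (A1 Hp →L[ℝ] ℝ) × (A1 Hp →L[ℝ] ℝ) :=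
  let x := p.1.1
  let X := p.1.2
  (traceFunctional (-(Complex.I / 2)) (adj x ∘L x - adj X ∘L X),
    traceFunctional (1 / 2) (adj X ∘L x - adj x ∘L X),
    traceFunctional (-(Complex.I / 2)) (adj X ∘L x + adj x ∘L X))

variable (Hp) in
/-- The value `ξ_k = (-(i/2) k² Tr, 0, 0)` of the moment map. -/
def levelValue (k : ℝ) : (A1 Hp →L[ℝ] ℝ) × (A1 Hp →L[ℝ] ℝ) × (A1 Hp →L[ℝ] ℝ) :=
  (traceFunctional (-(Complex.I / 2) * (k : ℂ) ^ 2) (ContinuousLinearMap.id ℂ Hp), 0, 0)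

variable (Hp) in
/-- The level set `W_k = μ⁻¹(ξ_k)`. -/
def levelSet (k : ℝ) : Set (TM Hp k) := momentMap Hp k ⁻¹' {levelValue Hp k}

end
end HyperkahlerGrassmannian

end

open HilbertIdeal BanachSubmanifold HyperkahlerGrassmannian

/-! In the global chart the level map is a polynomial of degree two with continuous coefficients,
hence smooth. The moment map equations are equivalent to the operator equations `X* x = 0` and `x* x
- X* X = k² Id`, because testing a functional on the skew-Hermitian operators `i ⟪v, ·⟫ v` recovers
the quadratic form of the operator behind it. So `W_k` is the zero set of the normalized level map.

The metric is only weak and the model space is not a Hilbert space, so neither a closed complement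
of the kernel nor an orthogonal projection comes for free. The complement is built by hand. Write
`D` for the differential at a point of `W_k`. The formal `g`-adjoint of `D` suggests the vectors `(X
A* + x B, x A - X B)`, with `A` trace class and `B` self-adjoint trace class. Cyclicity of the trace
makes them orthogonal to `ker D`. Since `X* x = 0`, applying `D` to them decouples into the
Sylvester expressions `M A* + A* N` and `(N + M) B + B (N + M)`, where `M = X* X ≥ 0` and `N = x* x
= k² + M`. As `k² > 0`, both are invertible on `L¹` by a Neumann series (`exists_sylvester`). This
gives a bounded right inverse `R` of `D` with range orthogonal to `ker D` (`exists_rightInverse`).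

Everything follows from `R`: surjectivity; the closed complement, which is the whole orthogonal of
the kernel by positive definiteness (`isTopCompl_ker_formOrthogonal`); and adapted charts, by the
inverse function theorem applied to `id + R (F - D)`, with `F` the normalized level map in the chart
(`exists_straightening`). The restricted metric is the pullback of a constant form by the inverse of
a chart, so it is smooth, and it is definite because that inverse has injective derivative. -/

namespace HilbertIdeal

local notation "adj" => ContinuousLinearMap.adjoint

variable {E F : Type*}
  [NormedAddCommGroup E] [InnerProductSpace ℂ E] [CompleteSpace E]
  [NormedAddCommGroup F] [InnerProductSpace ℂ F] [CompleteSpace F]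

/-! ### Completeness of the Schatten classes -/

/-- By duality the trace norm is controlled by finite sums `∑ |⟪eᵢ, S T eᵢ⟫|` with `‖S‖ ≤ 1`. Each
is continuous in the operator norm, so a bound passes to the limit. -/
theorem traceNorm_le_of_tendsto {u : ℕ → E →L[ℂ] E} {T : E →L[ℂ] E} {C : ℝ≥0∞}
    (hu : Tendsto u atTop (𝓝 T)) (hC : ∀ᶠ n in atTop, traceNorm (u n) ≤ C) :
    traceNorm T ≤ C := by
  refine traceNorm_le fun S hS => ?_
  rw [ENNReal.tsum_eq_iSup_sum]
  refine iSup_le fun s => ?_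
  have hcont : Continuous fun A : E →L[ℂ] E => ∑ i ∈ s, ‖⟪onb E i, S (A (onb E i))⟫_ℂ‖ₑ := by
    fun_prop
  refine le_of_tendsto ((hcont.tendsto T).comp hu) (hC.mono fun n hn => ?_)
  refine (ENNReal.sum_le_tsum s).trans ((tsum_enorm_inner_le_traceNorm (S ∘L u n)).trans ?_)
  refine (traceNorm_comp_le_left _ _).trans ((mul_le_of_le_one_left' (enorm_le_one hS)).trans hn)

theorem hsSq_le_of_tendsto {u : ℕ → E →L[ℂ] F} {T : E →L[ℂ] F} {C : ℝ≥0∞}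
    (hu : Tendsto u atTop (𝓝 T)) (hC : ∀ᶠ n in atTop, hsSq (u n) ≤ C) :
    hsSq T ≤ C := by
  unfold hsSq
  rw [ENNReal.tsum_eq_iSup_sum]
  refine iSup_le fun s => ?_
  have hcont : Continuous fun A : E →L[ℂ] F => ∑ i ∈ s, ‖A (onb E i)‖ₑ ^ 2 := by
    refine continuous_finsetSum _ fun i _ => ?_
    exact (ENNReal.continuous_pow 2).comp (by fun_prop)
  exact le_of_tendsto ((hcont.tendsto T).comp hu)
    (hC.mono fun n hn => (ENNReal.sum_le_tsum s).trans hn)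

/-- A normed space which embeds in a Banach space by a contraction whose domain norm is lower
semicontinuous for the norm of the Banach space is complete. -/
theorem completeSpace_of_lowerSemicontinuous {X Y : Type*} [NormedAddCommGroup X]
    [NormedAddCommGroup Y] [CompleteSpace Y] (f : X →+ Y) (hinj : Function.Injective f)
    (hf : ∀ x, ‖f x‖ ≤ ‖x‖)
    (hlsc : ∀ (u : ℕ → X) (y : Y) (C : ℝ), Tendsto (fun n => f (u n)) atTop (𝓝 y) →
      (∀ᶠ n in atTop, ‖u n‖ ≤ C) → ∃ x, f x = y ∧ ‖x‖ ≤ C) : CompleteSpace X := by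
  refine Metric.complete_of_cauchySeq_tendsto fun u hu => ?_
  have hfu : CauchySeq fun n => f (u n) := by
    rw [Metric.cauchySeq_iff] at hu ⊢
    intro ε hε
    obtain ⟨N, hN⟩ := hu ε hε
    refine ⟨N, fun m hm n hn => lt_of_le_of_lt ?_ (hN m hm n hn)⟩
    rw [dist_eq_norm, dist_eq_norm, ← map_sub]
    exact hf _
  obtain ⟨y, hy⟩ := cauchySeq_tendsto_of_complete hfu
  have key : ∀ ε > 0, ∃ N, ∀ n ≥ N, ∃ x, f x = y ∧ ‖u n - x‖ ≤ ε := by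
    intro ε hε
    obtain ⟨N, hN⟩ := Metric.cauchySeq_iff.1 hu ε hε
    refine ⟨N, fun n hn => ?_⟩
    -- For fixed `n`, lower semicontinuity is applied to `u n - u m` as `m → ∞`. The resulting limit
    -- point depends on `n`, but injectivity of `f` later identifies all of them.
    obtain ⟨x, hx, hxC⟩ := hlsc (fun m => u n - u m) (f (u n) - y) ε
      (by simpa using tendsto_const_nhds.sub hy)
      (eventually_atTop.2 ⟨N, fun m hm => by
        rw [← dist_eq_norm]; exact (hN n hn m hm).le⟩)
    exact ⟨u n - x, by rw [map_sub, hx]; abel, by simpa using hxC⟩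
  obtain ⟨N, hN⟩ := key 1 one_pos
  obtain ⟨x, hx, -⟩ := hN N le_rfl
  refine ⟨x, Metric.tendsto_atTop.2 fun ε hε => ?_⟩
  obtain ⟨N, hN⟩ := key (ε / 2) (half_pos hε)
  refine ⟨N, fun n hn => ?_⟩
  obtain ⟨x', hx', hn'⟩ := hN n hn
  rw [dist_eq_norm, hinj (hx.trans hx'.symm)]
  linarith

/-- Completeness serves both the Neumann series for the Sylvester operator and the inverse function
theorem on the model space. -/
instance : CompleteSpace (L1 E) :=
  completeSpace_of_lowerSemicontinuous (L1.op : L1 E →ₗ[ℂ] _).toAddMonoidHom L1.op_injective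
    L1.norm_op_le fun u T C hu hC => by
      have h : traceNorm T ≤ ENNReal.ofReal C :=
        traceNorm_le_of_tendsto hu (hC.mono fun n hn => by
          change traceNorm (L1.op (u n)) ≤ _
          rw [← ENNReal.ofReal_toReal (u n).traceNorm_lt_top.ne]
          exact ENNReal.ofReal_le_ofReal hn)
      have hC0 : 0 ≤ C := by
        obtain ⟨n, hn⟩ := hC.exists
        exact (norm_nonneg _).trans hn
      exact ⟨L1.mk T (h.trans_lt ENNReal.ofReal_lt_top), rfl,
        ENNReal.toReal_le_of_le_ofReal hC0 h⟩

instance : CompleteSpace (L2 E F) :=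
  completeSpace_of_lowerSemicontinuous (L2.op : L2 E F →ₗ[ℂ] _).toAddMonoidHom L2.op_injective
    L2.norm_op_le fun u T C hu hC => by
      have hC0 : 0 ≤ C := by
        obtain ⟨n, hn⟩ := hC.exists
        exact (norm_nonneg _).trans hn
      have h : hsSq T ≤ ENNReal.ofReal (C ^ 2) :=
        hsSq_le_of_tendsto hu (hC.mono fun n hn => by
          change hsSq (L2.op (u n)) ≤ _
          rw [← ENNReal.ofReal_toReal (u n).hsSq_lt_top.ne]
          exact ENNReal.ofReal_le_ofReal ((Real.sqrt_le_left hC0).1 hn))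
      refine ⟨L2.mk T (h.trans_lt ENNReal.ofReal_lt_top), rfl, ?_⟩
      exact (Real.sqrt_le_left hC0).2 (ENNReal.toReal_le_of_le_ofReal (sq_nonneg C) h)

/-! ### Bounded real linear operations on the trace class -/

namespace L1

/-- The adjoint, as a continuous real linear map of `L¹(E)`. -/
noncomputable def star : L1 E →L[ℝ] L1 E :=
  LinearMap.mkContinuous
    { toFun := fun T => mk (adj (op T)) (by rw [traceNorm_adjoint]; exact T.traceNorm_lt_top)
      map_add' := fun S T => by ext1; simp
      map_smul' := fun c T => by
        ext1
        rw [op_mk, op_real_smul, RingHom.id_apply, op_real_smul, op_mk, map_smulₛₗ,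
          Complex.conj_ofReal] }
    1 fun T => by
      rw [one_mul]
      exact (congrArg ENNReal.toReal (traceNorm_adjoint (op T))).le

@[simp] theorem op_star (T : L1 E) : op (star T) = adj (op T) := rfl

/-- Left multiplication by a bounded operator on `L¹(E)`. -/
noncomputable def mulLeft (S : E →L[ℂ] E) : L1 E →L[ℝ] L1 E :=
  LinearMap.mkContinuous
    { toFun := fun T => mk (S ∘L op T) ((traceNorm_comp_le_left _ _).trans_lt
        (ENNReal.mul_lt_top (by simp) T.traceNorm_lt_top))
      map_add' := fun T T' => by ext1; simp
      map_smul' := fun c T => by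
        ext1; simp }
    ‖S‖ fun T => by
      have h := ENNReal.toReal_mono (ENNReal.mul_lt_top (by simp) T.traceNorm_lt_top).ne
        (traceNorm_comp_le_left S (op T))
      rwa [ENNReal.toReal_mul, toReal_enorm] at h

@[simp] theorem op_mulLeft (S : E →L[ℂ] E) (T : L1 E) : op (mulLeft S T) = S ∘L op T := rfl

theorem norm_mulLeft_le (S : E →L[ℂ] E) : ‖mulLeft S‖ ≤ ‖S‖ :=
  LinearMap.mkContinuous_norm_le _ (norm_nonneg S) _

/-- Right multiplication by a bounded operator on `L¹(E)`. -/
noncomputable def mulRight (S : E →L[ℂ] E) : L1 E →L[ℝ] L1 E :=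
  LinearMap.mkContinuous
    { toFun := fun T => mk (op T ∘L S) ((traceNorm_comp_le_right _ _).trans_lt
        (ENNReal.mul_lt_top (by simp) T.traceNorm_lt_top))
      map_add' := fun T T' => by ext1; simp
      map_smul' := fun c T => by
        ext1; simp }
    ‖S‖ fun T => by
      have h := ENNReal.toReal_mono (ENNReal.mul_lt_top (by simp) T.traceNorm_lt_top).ne
        (traceNorm_comp_le_right (op T) S)
      rwa [ENNReal.toReal_mul, toReal_enorm] at h

@[simp] theorem op_mulRight (S : E →L[ℂ] E) (T : L1 E) : op (mulRight S T) = op T ∘L S := rfl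

theorem norm_mulRight_le (S : E →L[ℂ] E) : ‖mulRight S‖ ≤ ‖S‖ :=
  LinearMap.mkContinuous_norm_le _ (norm_nonneg S) _

end L1

/-! ### The Sylvester operator -/

/-- From `a ≤ P ≤ ‖P‖ ≤ M` one gets `0 ≤ M - P ≤ M - a`, and the C*-norm is monotone on positive
elements. -/
theorem norm_sub_le_of_le {P : E →L[ℂ] E} {a M : ℝ} (hP : IsSelfAdjoint P)
    (ha : algebraMap ℝ (E →L[ℂ] E) a ≤ P) (hM : ‖P‖ ≤ M) :
    ‖algebraMap ℝ (E →L[ℂ] E) M - P‖ ≤ |M - a| := by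
  have h1 : P ≤ algebraMap ℝ (E →L[ℂ] E) M :=
    hP.le_algebraMap_norm_self.trans (algebraMap_mono _ hM)
  have h2 : algebraMap ℝ (E →L[ℂ] E) M - P ≤ algebraMap ℝ (E →L[ℂ] E) (M - a) := by
    rw [map_sub]
    exact sub_le_sub_left ha _
  refine (CStarAlgebra.norm_le_norm_of_nonneg_of_le (sub_nonneg.2 h1) h2).trans ?_
  rw [Algebra.algebraMap_eq_smul_one, norm_smul, Real.norm_eq_abs]
  exact mul_le_of_le_one_right (abs_nonneg _) ContinuousLinearMap.norm_id_le

/-- The Sylvester operator `A ↦ P A + A Q` is invertible on `L¹(E)` if the lower bounds of the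
self-adjoint operators `P` and `Q` have a positive sum. -/
theorem exists_sylvester {P Q : E →L[ℂ] E} {a b : ℝ} (hP : IsSelfAdjoint P)
    (hQ : IsSelfAdjoint Q) (ha : algebraMap ℝ (E →L[ℂ] E) a ≤ P)
    (hb : algebraMap ℝ (E →L[ℂ] E) b ≤ Q) (hab : 0 < a + b) :
    ∃ e : L1 E ≃L[ℝ] L1 E, ∀ A, L1.op (e A) = P ∘L L1.op A + L1.op A ∘L Q := by
  obtain ⟨M, hMP, hMQ, hMa, hMb⟩ : ∃ M : ℝ, ‖P‖ ≤ M ∧ ‖Q‖ ≤ M ∧ |a| ≤ M ∧ |b| ≤ M :=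
    ⟨max (max ‖P‖ ‖Q‖) (max |a| |b|), by simp, by simp, by simp, by simp⟩
  have ha' := le_abs_self a
  have hb' := le_abs_self b
  have hM : 0 < 2 * M := by linarith
  have h1 := norm_sub_le_of_le hP ha hMP
  have h2 := norm_sub_le_of_le hQ hb hMQ
  rw [abs_of_nonneg (by linarith)] at h1 h2
  set P' := algebraMap ℝ (E →L[ℂ] E) M - P
  set Q' := algebraMap ℝ (E →L[ℂ] E) M - Q
  -- `P A + A Q = 2M (A - t A)` with `‖t‖ ≤ ((M - a) + (M - b)) / 2M < 1`, because multiplications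
  -- on `L¹` are bounded by the operator norm. So `1 - t` is a unit.
  set t : L1 E →L[ℝ] L1 E := (2 * M)⁻¹ • (L1.mulLeft P' + L1.mulRight Q') with ht
  have htn : ‖t‖ < 1 := by
    have h3 := norm_add_le (L1.mulLeft P') (L1.mulRight Q')
    have h4 := L1.norm_mulLeft_le P'
    have h5 := L1.norm_mulRight_le Q'
    rw [ht, norm_smul, norm_inv, Real.norm_of_nonneg hM.le, inv_mul_lt_one₀ hM]
    linarith
  let e₁ := ContinuousLinearEquiv.unitsEquiv ℝ (L1 E) (Units.oneSub t htn)
  let e₂ := ContinuousLinearEquiv.smulLeft (R₁ := ℝ) (M₁ := L1 E) (Units.mk0 (2 * M) hM.ne')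
  refine ⟨e₁.trans e₂, fun A => ?_⟩
  have h6 : (e₁.trans e₂) A = (2 * M) • A - (L1.mulLeft P' A + L1.mulRight Q' A) := by
    change (2 * M) • (A - (2 * M)⁻¹ • (L1.mulLeft P' A + L1.mulRight Q' A)) = _
    rw [smul_sub, smul_inv_smul₀ hM.ne']
  rw [h6, map_sub, map_add, op_real_smul]
  ext v
  simp [P', Q', Algebra.algebraMap_eq_smul_one, two_mul, add_smul]
  abel

/-! ### Cyclicity of the trace -/

theorem trace_adjoint (T : E →L[ℂ] E) : trace (adj T) = (starRingEnd ℂ) (trace T) := by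
  unfold trace
  rw [Complex.conj_tsum]
  refine tsum_congr fun i => ?_
  rw [ContinuousLinearMap.adjoint_inner_right, inner_conj_symm]

theorem inner_comp_eq_tsum {S T : E →L[ℂ] E} (i : BasisIndex E) :
    ⟪onb E i, (S ∘L T) (onb E i)⟫_ℂ =
      ∑' j, ⟪onb E i, S (onb E j)⟫_ℂ * ⟪onb E j, T (onb E i)⟫_ℂ := by
  rw [ContinuousLinearMap.comp_apply, ← ContinuousLinearMap.adjoint_inner_left,
    ← (onb E).tsum_inner_mul_inner]
  simp_rw [ContinuousLinearMap.adjoint_inner_left]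

/-- Both matrices have square summable entries, so by Cauchy-Schwarz the double series `∑ Sᵢⱼ Tⱼᵢ`
converges absolutely and its two sums can be exchanged. -/
theorem trace_comm_of_hsSq_lt_top {S T : E →L[ℂ] E} (hS : hsSq S < ⊤) (hT : hsSq T < ⊤) :
    trace (S ∘L T) = trace (T ∘L S) := by
  have hsq : ∀ A : E →L[ℂ] E,
      ∑' p : BasisIndex E × BasisIndex E, ‖⟪onb E p.1, A (onb E p.2)⟫_ℂ‖ₑ ^ 2 = hsSq A := by
    intro A
    calc _ = ∑' (i : BasisIndex E) (j : BasisIndex E), ‖⟪onb E i, A (onb E j)⟫_ℂ‖ₑ ^ 2 :=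
          ENNReal.tsum_prod (f := fun i j : BasisIndex E => ‖⟪onb E i, A (onb E j)⟫_ℂ‖ₑ ^ 2)
      _ = ∑' (j : BasisIndex E) (i : BasisIndex E), ‖⟪onb E i, A (onb E j)⟫_ℂ‖ₑ ^ 2 :=
          ENNReal.tsum_comm
      _ = hsSq A := tsum_congr fun j => (parseval (onb E) (A (onb E j))).symm
  have hsum : Summable fun p : BasisIndex E × BasisIndex E =>
      ⟪onb E p.1, S (onb E p.2)⟫_ℂ * ⟪onb E p.2, T (onb E p.1)⟫_ℂ := by
    refine Summable.of_norm ?_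
    have h' : ∑' p : BasisIndex E × BasisIndex E, ‖⟪onb E p.2, T (onb E p.1)⟫_ℂ‖ₑ ^ 2 =
        hsSq T := by
      rw [ENNReal.tsum_prod (f := fun i j : BasisIndex E => ‖⟪onb E j, T (onb E i)⟫_ℂ‖ₑ ^ 2)]
      exact tsum_congr fun i => (parseval (onb E) (T (onb E i))).symm
    have h := tsum_mul_le
      (fun p : BasisIndex E × BasisIndex E => ‖⟪onb E p.1, S (onb E p.2)⟫_ℂ‖ₑ)
      (fun p => ‖⟪onb E p.2, T (onb E p.1)⟫_ℂ‖ₑ)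
    rw [hsq S, h'] at h
    have h2 := h.trans_lt (ENNReal.mul_lt_top
      (ENNReal.rpow_lt_top_of_nonneg (by norm_num) hS.ne)
      (ENNReal.rpow_lt_top_of_nonneg (by norm_num) hT.ne))
    simpa [ENNReal.toReal_mul] using ENNReal.summable_toReal h2.ne
  calc trace (S ∘L T) = ∑' (i : BasisIndex E) (j : BasisIndex E),
        ⟪onb E i, S (onb E j)⟫_ℂ * ⟪onb E j, T (onb E i)⟫_ℂ :=
      tsum_congr fun i => inner_comp_eq_tsum i
    _ = ∑' (j : BasisIndex E) (i : BasisIndex E),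
        ⟪onb E i, S (onb E j)⟫_ℂ * ⟪onb E j, T (onb E i)⟫_ℂ :=
      (Summable.tsum_comm (f := fun i j : BasisIndex E =>
        ⟪onb E i, S (onb E j)⟫_ℂ * ⟪onb E j, T (onb E i)⟫_ℂ) hsum).symm
    _ = trace (T ∘L S) := by
      refine tsum_congr fun j => ?_
      rw [inner_comp_eq_tsum j]
      exact tsum_congr fun i => mul_comm _ _

/-- The polar decomposition gives `A = U P P` with `P = |A|^{1/2}` Hilbert-Schmidt. The two factors
`P` are moved around `B` one at a time, so that each exchange involves two Hilbert-Schmidt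
operators. -/
theorem trace_comm {A : E →L[ℂ] E} (hA : traceNorm A < ⊤) (B : E →L[ℂ] E) :
    trace (A ∘L B) = trace (B ∘L A) := by
  obtain ⟨U, -, hU, -⟩ := exists_polar A
  set P := CFC.sqrt (CFC.abs A) with hP
  have hsq : P ∘L P = CFC.abs A := CFC.sqrt_mul_sqrt_self _ (CFC.abs_nonneg A)
  have hPhs : hsSq P < ⊤ := by rwa [hP, ← traceNorm_eq_hsSq]
  have hleft : ∀ C : E →L[ℂ] E, hsSq (C ∘L P) < ⊤ := fun C =>
    (hsSq_comp_le_left _ _).trans_lt (ENNReal.mul_lt_top (by simp) hPhs)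
  have hright : ∀ C : E →L[ℂ] E, hsSq (P ∘L C) < ⊤ := fun C =>
    (hsSq_comp_le_right _ _).trans_lt (ENNReal.mul_lt_top (by simp) hPhs)
  rw [hU, ← hsq]
  calc trace ((U ∘L P ∘L P) ∘L B) = trace ((U ∘L P) ∘L (P ∘L B)) := rfl
    _ = trace ((P ∘L B) ∘L (U ∘L P)) := trace_comm_of_hsSq_lt_top (hleft U) (hright B)
    _ = trace (P ∘L ((B ∘L U) ∘L P)) := rfl
    _ = trace (((B ∘L U) ∘L P) ∘L P) := trace_comm_of_hsSq_lt_top hPhs (hleft _)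
    _ = trace (B ∘L U ∘L P ∘L P) := rfl

/-! ### Positivity of `Re Tr (T* T)`, and rank one operators as test operators. -/

theorem re_trace_adjoint_comp_self (T : E →L[ℂ] F) (h : traceNorm (adj T ∘L T) < ⊤) :
    (trace (adj T ∘L T)).re = ∑' i, ‖T (onb E i)‖ ^ 2 ∧ Summable fun i => ‖T (onb E i)‖ ^ 2 := by
  have h1 : ∀ i, ⟪onb E i, (adj T ∘L T) (onb E i)⟫_ℂ = ((‖T (onb E i)‖ ^ 2 : ℝ) : ℂ) := fun i => by
    rw [ContinuousLinearMap.comp_apply, ContinuousLinearMap.adjoint_inner_right,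
      inner_self_eq_norm_sq_to_K]
    norm_cast
  have h2 := summable_trace h
  simp_rw [h1] at h2
  refine ⟨?_, Complex.summable_ofReal.1 h2⟩
  unfold trace
  simp_rw [h1]
  rw [← Complex.ofReal_tsum, Complex.ofReal_re]

theorem re_trace_adjoint_comp_self_pos {T : E →L[ℂ] F} (h : traceNorm (adj T ∘L T) < ⊤)
    (hT : T ≠ 0) : 0 < (trace (adj T ∘L T)).re := by
  obtain ⟨h1, h2⟩ := re_trace_adjoint_comp_self T h
  obtain ⟨i, hi⟩ : ∃ i, T (onb E i) ≠ 0 := by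
    by_contra! h0
    have hpos : hsSq T = 0 := by simp [hsSq, h0]
    have h3 := enorm_sq_le_hsSq T
    rw [hpos] at h3
    exact hT (by simpa using h3)
  rw [h1]
  exact h2.tsum_pos (fun i => by positivity) i (by positivity)

/-- The sum is the Parseval expansion of the inner product. With it, the trace pairing against rank
one operators reads off the quadratic form of `B`. -/
theorem trace_comp_rankOne (B : E →L[ℂ] E) (v : E) :
    trace (B ∘L InnerProductSpace.rankOne ℂ v v) = ⟪v, B v⟫_ℂ := by
  unfold trace
  rw [← (onb E).tsum_inner_mul_inner]
  refine tsum_congr fun i => ?_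
  simp

theorem traceNorm_rankOne_lt_top (v : E) :
    traceNorm (InnerProductSpace.rankOne ℂ v v : E →L[ℂ] E) < ⊤ := by
  refine (traceNorm_le (C := ‖v‖ₑ * ‖v‖ₑ) fun S hS => ?_).trans_lt
    (ENNReal.mul_lt_top (by simp) (by simp))
  -- Cauchy-Schwarz and Parseval bound the sum by `‖v‖ ‖S v‖`.
  have h := tsum_mul_le (fun i => ‖⟪onb E i, v⟫_ℂ‖ₑ) (fun i => ‖⟪onb E i, S v⟫_ℂ‖ₑ)
  rw [← parseval, ← parseval, ← ENNReal.rpow_natCast_mul, ← ENNReal.rpow_natCast_mul] at h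
  norm_num at h
  refine le_trans (le_of_eq (tsum_congr fun i => ?_)) (h.trans ?_)
  · rw [InnerProductSpace.rankOne_apply, map_smul, inner_smul_right, enorm_mul,
      ← inner_conj_symm v]
    congr 1
    exact RCLike.enorm_conj _
  · gcongr
    refine (S.le_opENorm v).trans (mul_le_of_le_one_left' (enorm_le_one hS))

end HilbertIdeal

namespace HyperkahlerGrassmannian

local notation "adj" => ContinuousLinearMap.adjoint

variable {H : Type*} [NormedAddCommGroup H] [InnerProductSpace ℂ H] [CompleteSpace H]
  {Hp : Submodule ℂ H} [CompleteSpace Hp]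

/-! ### The model space and its bilinear products -/

theorem opOf_injective : Function.Injective (opOf : Model Hp → Hp →L[ℂ] H) := by
  intro Z W h
  have h1 := congrArg (fun A => pPlus Hp ∘L A) h
  have h2 := congrArg (fun A => pMinus Hp ∘L A) h
  simp only [opOf, pPlus_add, pMinus_add] at h1 h2
  exact Prod.ext (L1.ext h1) (L2.ext h2)

theorem adjoint_subtypeL_comp_opOf (Z : Model Hp) : adj Hp.subtypeL ∘L opOf Z = L1.op Z.1 := by
  rw [Submodule.adjoint_subtypeL]
  exact pPlus_add _ _

theorem adjoint_opOf_comp_subtypeL (Z : Model Hp) :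
    adj (opOf Z) ∘L Hp.subtypeL = adj (L1.op Z.1) := by
  rw [← adjoint_subtypeL_comp_opOf, ContinuousLinearMap.adjoint_comp,
    ContinuousLinearMap.adjoint_adjoint]

theorem adjoint_subtypeL_comp_subtypeL :
    adj Hp.subtypeL ∘L Hp.subtypeL = ContinuousLinearMap.id ℂ Hp := by
  rw [Submodule.adjoint_subtypeL]
  ext v
  simp

theorem adjoint_real_smul {E F : Type*} [NormedAddCommGroup E] [InnerProductSpace ℂ E]
    [CompleteSpace E] [NormedAddCommGroup F] [InnerProductSpace ℂ F] [CompleteSpace F]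
    (c : ℝ) (T : E →L[ℂ] F) : adj ((c : ℂ) • T) = (c : ℂ) • adj T := by
  rw [map_smulₛₗ, Complex.conj_ofReal]

variable (Hp) in
/-- The real bilinear map `(Z, W) ↦ Z* W` with values in the trace class. -/
noncomputable def gram : Model Hp →L[ℝ] Model Hp →L[ℝ] L1 Hp :=
  LinearMap.mkContinuous₂
    (LinearMap.mk₂ ℝ (fun Z W : Model Hp => L1.mk (adj (opOf Z) ∘L opOf W)
        (traceNorm_opOf_lt_top Z W))
      (fun Z Z' W => by
        ext1; simp only [L1.op_mk, map_add, opOf_add, ContinuousLinearMap.add_comp])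
      (fun c Z W => by
        ext1
        rw [op_real_smul, L1.op_mk, L1.op_mk, opOf_real_smul, adjoint_real_smul,
          ContinuousLinearMap.smul_comp])
      (fun Z W W' => by
        ext1; simp only [L1.op_mk, map_add, opOf_add, ContinuousLinearMap.comp_add])
      (fun c Z W => by
        ext1
        rw [op_real_smul, L1.op_mk, L1.op_mk, opOf_real_smul, ContinuousLinearMap.comp_smul])) 2
    fun Z W => traceNorm_opOf_le Z W

@[simp] theorem op_gram (Z W : Model Hp) : L1.op (gram Hp Z W) = adj (opOf Z) ∘L opOf W := rfl

/-- Composition `A ↦ x A` of trace class operators with an operator whose `H₋`-component is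
Hilbert-Schmidt. -/
noncomputable def compModel (x : Hp →L[ℂ] H) (hx : hsSq (pMinus Hp ∘L x) < ⊤) :
    L1 Hp →L[ℝ] Model Hp :=
  (L1.mulLeft (pPlus Hp ∘L x)).prod
    (LinearMap.mkContinuous
      { toFun := fun A => L2.mk ((pMinus Hp ∘L x) ∘L L1.op A)
          ((hsSq_comp_le_right _ _).trans_lt (ENNReal.mul_lt_top (by simp) hx))
        map_add' := fun A B => by ext1; simp
        map_smul' := fun c A => by
          ext1
          refine Eq.trans ?_ (L2.op.map_smul (c : ℂ) _).symm
          rw [L2.op_mk, L2.op_mk, op_real_smul, ContinuousLinearMap.comp_smul] }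
      (√(hsSq (pMinus Hp ∘L x)).toReal) fun A => by
        have h := ENNReal.toReal_mono (ENNReal.mul_lt_top (by simp) hx).ne
          (hsSq_comp_le_right (pMinus Hp ∘L x) (L1.op A))
        rw [ENNReal.toReal_mul, ENNReal.toReal_pow, toReal_enorm] at h
        refine (Real.sqrt_le_sqrt h).trans ?_
        rw [Real.sqrt_mul (by positivity), Real.sqrt_sq (norm_nonneg _), mul_comm]
        gcongr
        exact A.norm_op_le)

@[simp] theorem opOf_compModel (x : Hp →L[ℂ] H) (hx : hsSq (pMinus Hp ∘L x) < ⊤) (A : L1 Hp) :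
    opOf (compModel x hx A) = x ∘L L1.op A :=
  decomp (x ∘L L1.op A)

/-- The real part `T ↦ (T + T*) / 2` of a trace class operator. -/
noncomputable def selfAdjointPart (E : Type*) [NormedAddCommGroup E] [InnerProductSpace ℂ E]
    [CompleteSpace E] : L1 E →L[ℝ] S1 E :=
  ((1 / 2 : ℝ) • (ContinuousLinearMap.id ℝ (L1 E) + L1.star)).codRestrict (S1 E) fun T => by
    change adj (L1.op ((1 / 2 : ℝ) • (T + L1.star T))) = L1.op ((1 / 2 : ℝ) • (T + L1.star T))
    rw [op_real_smul, adjoint_real_smul, map_add, map_add, L1.op_star,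
      ContinuousLinearMap.adjoint_adjoint, add_comm]

theorem selfAdjointPart_apply {E : Type*} [NormedAddCommGroup E] [InnerProductSpace ℂ E]
    [CompleteSpace E] (T : L1 E) :
    L1.op (selfAdjointPart E T).1 = ((1 / 2 : ℝ) : ℂ) • (L1.op T + adj (L1.op T)) := by
  change L1.op ((1 / 2 : ℝ) • (T + L1.star T)) = _
  rw [op_real_smul, map_add, L1.op_star]

theorem selfAdjointPart_of_mem {E : Type*} [NormedAddCommGroup E] [InnerProductSpace ℂ E]
    [CompleteSpace E] {T : L1 E} (hT : adj (L1.op T) = L1.op T) :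
    (selfAdjointPart E T).1 = T := by
  ext1
  rw [selfAdjointPart_apply, hT, ← two_smul ℂ (L1.op T), smul_smul]
  norm_num

/-! ### The level map in the global chart -/

theorem coords_symm_fst {k : ℝ} (z : Model Hp × Model Hp) :
    ((coords k).symm z).1.1 = (k : ℂ) • Hp.subtypeL + opOf z.1 := rfl

theorem coords_symm_snd {k : ℝ} (z : Model Hp × Model Hp) :
    ((coords k).symm z).1.2 = opOf z.2 := rfl

/-- Substitute `x = k ι + Z` and `X = T`, where `ι` is the inclusion of `H₊` and `ι* = p₊`; the
constant `k² Id` cancels. The factor `2 k` compensates the `1/2` in the self-adjoint part, since the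
linear term is `k (p₊ Z + (p₊ Z)*)`. Writing the second component through the projection onto `S¹`
keeps values and derivatives in that subspace. -/
theorem levelMap_coords_symm (k : ℝ) (z : Model Hp × Model Hp) :
    levelMap Hp k ((coords k).symm z) = (k • L1.star z.2.1 + gram Hp z.2 z.1,
      selfAdjointPart Hp ((2 * k) • z.1.1 + gram Hp z.1 z.1 - gram Hp z.2 z.2)) := by
  refine Prod.ext ?_ (Subtype.ext ?_)
  · refine L1.ext ?_
    change adj (opOf z.2) ∘L ((k : ℂ) • Hp.subtypeL + opOf z.1) = _
    rw [map_add, op_real_smul, L1.op_star, op_gram, ContinuousLinearMap.comp_add,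
      ContinuousLinearMap.comp_smul, adjoint_opOf_comp_subtypeL]
  · refine L1.ext ?_
    rw [selfAdjointPart_apply]
    change adj ((k : ℂ) • Hp.subtypeL + opOf z.1) ∘L ((k : ℂ) • Hp.subtypeL + opOf z.1) -
      adj (opOf z.2) ∘L opOf z.2 - ((k ^ 2 : ℝ) : ℂ) • ContinuousLinearMap.id ℂ Hp = _
    simp only [map_add, map_sub, op_real_smul, op_gram, adjoint_real_smul,
      ContinuousLinearMap.comp_add, ContinuousLinearMap.add_comp, ContinuousLinearMap.comp_smul,
      ContinuousLinearMap.smul_comp, adjoint_opOf_comp_subtypeL, adjoint_subtypeL_comp_opOf,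
      adjoint_subtypeL_comp_subtypeL, ContinuousLinearMap.adjoint_comp,
      ContinuousLinearMap.adjoint_adjoint]
    push_cast
    module

theorem contDiff_levelMap_coords_symm (k : ℝ) :
    ContDiff ℝ ∞ fun z : Model Hp × Model Hp => levelMap Hp k ((coords k).symm z) := by
  simp_rw [levelMap_coords_symm]
  have h : ContDiff ℝ ∞ fun z : Model Hp × Model Hp => L1.star z.2.1 :=
    L1.star.contDiff.comp (contDiff_fst.comp contDiff_snd)
  have hg : ∀ f g : Model Hp × Model Hp → Model Hp, ContDiff ℝ ∞ f → ContDiff ℝ ∞ g →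
      ContDiff ℝ ∞ fun z => gram Hp (f z) (g z) := fun f g hf hg =>
    ((gram Hp).contDiff.comp hf).clm_apply hg
  refine ((h.const_smul k).add (hg _ _ contDiff_snd contDiff_fst)).prodMk
    ((selfAdjointPart Hp).contDiff.comp (((ContDiff.const_smul _ ?_).add ?_).sub ?_))
  · exact contDiff_fst.comp contDiff_fst
  · exact hg _ _ contDiff_fst contDiff_fst
  · exact hg _ _ contDiff_snd contDiff_snd

/-- The differential of the level map is
`(Z, T) ↦ (T* x + X* Z, x* Z + Z* x - X* T - T* X)`. -/
theorem exists_hasFDerivAt_levelMap (k : ℝ) (p : TM Hp k) :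
    ∃ D : Model Hp × Model Hp →L[ℝ] L1 Hp × S1 Hp,
      HasFDerivAt (fun z => levelMap Hp k ((coords k).symm z)) D (coords k p) ∧
      ∀ w, L1.op (D w).1 = adj (opOf w.2) ∘L p.1.1 + adj p.1.2 ∘L opOf w.1 ∧
        L1.op (D w).2.1 = adj p.1.1 ∘L opOf w.1 + adj (opOf w.1) ∘L p.1.1 -
          (adj p.1.2 ∘L opOf w.2 + adj (opOf w.2) ∘L p.1.2) := by
  obtain ⟨z, rfl⟩ := (coords k).symm.surjective p
  rw [Equiv.apply_symm_apply, coords_symm_fst, coords_symm_snd]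
  simp_rw [levelMap_coords_symm]
  have h1 : HasFDerivAt (fun z : Model Hp × Model Hp => z.1)
    (ContinuousLinearMap.fst ℝ (Model Hp) (Model Hp)) z := hasFDerivAt_fst
  have h2 : HasFDerivAt (fun z : Model Hp × Model Hp => z.2)
    (ContinuousLinearMap.snd ℝ (Model Hp) (Model Hp)) z := hasFDerivAt_snd
  refine ⟨_, HasFDerivAt.prodMk
    (((L1.star.hasFDerivAt.comp z h2.fst).const_smul k).add
      ((gram Hp).hasFDerivAt_of_bilinear h2 h1))
    ((selfAdjointPart Hp).hasFDerivAt.comp z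
      (((h1.fst.const_smul (2 * k)).add ((gram Hp).hasFDerivAt_of_bilinear h1 h1)).sub
        ((gram Hp).hasFDerivAt_of_bilinear h2 h2))), fun w => ⟨?_, ?_⟩⟩
  · change L1.op (k • L1.star w.2.1 + (gram Hp z.2 w.1 + gram Hp w.2 z.1)) = _
    simp only [map_add, op_real_smul, op_gram, L1.op_star, ContinuousLinearMap.comp_add,
      ContinuousLinearMap.comp_smul, adjoint_opOf_comp_subtypeL]
    abel
  · change L1.op (selfAdjointPart Hp ((2 * k) • w.1.1 + (gram Hp z.1 w.1 + gram Hp w.1 z.1) -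
      (gram Hp z.2 w.2 + gram Hp w.2 z.2))).1 = _
    rw [selfAdjointPart_apply]
    simp only [map_add, map_sub, op_real_smul, op_gram, adjoint_real_smul,
      ContinuousLinearMap.comp_add, ContinuousLinearMap.add_comp, ContinuousLinearMap.comp_smul,
      ContinuousLinearMap.smul_comp, adjoint_opOf_comp_subtypeL, adjoint_subtypeL_comp_opOf,
      ContinuousLinearMap.adjoint_comp, ContinuousLinearMap.adjoint_adjoint]
    push_cast
    module

/-! ### The metric -/

theorem reTraceForm_apply (Z W : Model Hp) :
    reTraceForm Hp Z W = (trace (adj (opOf Z) ∘L opOf W)).re := rfl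

theorem reTraceForm_symm (Z W : Model Hp) : reTraceForm Hp Z W = reTraceForm Hp W Z := by
  rw [reTraceForm_apply, reTraceForm_apply, ← Complex.conj_re, ← trace_adjoint,
    ContinuousLinearMap.adjoint_comp, ContinuousLinearMap.adjoint_adjoint]

theorem reTraceForm_self_pos {Z : Model Hp} (hZ : Z ≠ 0) : 0 < reTraceForm Hp Z Z := by
  refine re_trace_adjoint_comp_self_pos (traceNorm_opOf_lt_top Z Z) fun h => hZ ?_
  exact opOf_injective (h.trans (by simp [opOf]))

variable (Hp) in
/-- The weak Riemannian metric as a form on the model space. -/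
noncomputable def modelMetric :
    Model Hp × Model Hp →L[ℝ] Model Hp × Model Hp →L[ℝ] ℝ :=
  (reTraceForm Hp).bilinearComp (ContinuousLinearMap.fst ℝ _ _) (ContinuousLinearMap.fst ℝ _ _) +
    (reTraceForm Hp).bilinearComp (ContinuousLinearMap.snd ℝ _ _) (ContinuousLinearMap.snd ℝ _ _)

theorem modelMetric_apply (z w : Model Hp × Model Hp) :
    modelMetric Hp z w = reTraceForm Hp z.1 w.1 + reTraceForm Hp z.2 w.2 := rfl

theorem modelMetric_symm (z w : Model Hp × Model Hp) :
    modelMetric Hp z w = modelMetric Hp w z := by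
  rw [modelMetric_apply, modelMetric_apply, reTraceForm_symm, reTraceForm_symm z.2]

theorem modelMetric_self_pos {z : Model Hp × Model Hp} (hz : z ≠ 0) : 0 < modelMetric Hp z z := by
  have h0 : ∀ Z : Model Hp, 0 ≤ reTraceForm Hp Z Z := fun Z => by
    by_cases hZ : Z = 0
    · simp [hZ]
    · exact (reTraceForm_self_pos hZ).le
  rw [modelMetric_apply]
  by_cases h1 : z.1 = 0
  · exact add_pos_of_nonneg_of_pos (h0 _)
      (reTraceForm_self_pos fun h2 => hz (Prod.ext h1 h2))
  · exact add_pos_of_pos_of_nonneg (reTraceForm_self_pos h1) (h0 _)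

end HyperkahlerGrassmannian

namespace HyperkahlerGrassmannian

local notation "adj" => ContinuousLinearMap.adjoint

variable {H : Type*} [NormedAddCommGroup H] [InnerProductSpace ℂ H] [CompleteSpace H]
  {Hp : Submodule ℂ H} [CompleteSpace Hp]

/-! ### The equations of the level set -/

theorem traceFunctional_apply (c : ℂ) (B : Hp →L[ℂ] Hp) (a : A1 Hp) :
    traceFunctional c B a = (c * trace (B ∘L L1.op a.1)).re := rfl

/-- The skew-Hermitian rank one operator `i ⟪v, ·⟫ v`. -/
noncomputable def skewRankOne (v : Hp) : A1 Hp :=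
  ⟨Complex.I • L1.mk (InnerProductSpace.rankOne ℂ v v) (traceNorm_rankOne_lt_top v), by
    change adj _ = - _
    rw [map_smul, L1.op_mk, map_smulₛₗ, Complex.conj_I, InnerProductSpace.adjoint_rankOne,
      neg_smul]⟩

theorem traceFunctional_skewRankOne (c : ℂ) (B : Hp →L[ℂ] Hp) (v : Hp) :
    traceFunctional c B (skewRankOne v) = (c * (Complex.I * ⟪v, B v⟫_ℂ)).re := by
  rw [traceFunctional_apply, skewRankOne, map_smul, L1.op_mk, ContinuousLinearMap.comp_smul,
    trace_smul, trace_comp_rankOne]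

/-- Polarization over `ℂ`; no symmetry of the operator is needed. -/
theorem eq_zero_of_inner_self_eq_zero {T : Hp →L[ℂ] Hp} (h : ∀ v, ⟪v, T v⟫_ℂ = 0) : T = 0 := by
  have h1 : (T : Hp →ₗ[ℂ] Hp) = 0 := inner_map_self_eq_zero (T : Hp →ₗ[ℂ] Hp) |>.1 fun v => by
    rw [← inner_conj_symm]
    simp [h v]
  exact ContinuousLinearMap.coe_injective h1

/-- The functionals of the moment map, evaluated on the skew-Hermitian rank one operators, determine
the quadratic forms of `X* x` and `x* x - X* X`, hence these operators. The converse is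
substitution. -/
theorem mem_levelSet_iff {k : ℝ} {p : TM Hp k} :
    p ∈ levelSet Hp k ↔ adj p.1.2 ∘L p.1.1 = 0 ∧
      adj p.1.1 ∘L p.1.1 - adj p.1.2 ∘L p.1.2 =
        ((k ^ 2 : ℝ) : ℂ) • ContinuousLinearMap.id ℂ Hp := by
  obtain ⟨⟨x, X⟩, hp⟩ := p
  change (_ = _) ↔ _
  simp only [momentMap, levelValue, Prod.mk.injEq]
  have hadj : adj x ∘L X = adj (adj X ∘L x) := by
    rw [ContinuousLinearMap.adjoint_comp, ContinuousLinearMap.adjoint_adjoint]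
  constructor
  · rintro ⟨h1, h2, h3⟩
    refine ⟨eq_zero_of_inner_self_eq_zero fun v => ?_, ?_⟩
    · have h2 := congrArg (fun f => f (skewRankOne v)) h2
      have h3 := congrArg (fun f => f (skewRankOne v)) h3
      simp only [traceFunctional_skewRankOne, hadj, _root_.sub_apply, _root_.add_apply,
        inner_sub_right, inner_add_right, ContinuousLinearMap.adjoint_inner_right (adj X ∘L x),
        _root_.zero_apply] at h2 h3
      rw [← inner_conj_symm ((adj X ∘L x) v)] at h2 h3
      -- With `a = ⟪v, X* x v⟫`, the form of `x* X` is the conjugate of `a`. The third equation then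
      -- says `Re a = 0` and the second `Im a = 0`.
      generalize ⟪v, (adj X ∘L x) v⟫_ℂ = a at h2 h3
      refine Complex.ext ?_ ?_
      · simpa using h3
      · simpa using h2
    · refine sub_eq_zero.1 (eq_zero_of_inner_self_eq_zero fun v => ?_)
      have h1 := congrArg (fun f => f (skewRankOne v)) h1
      simp only [traceFunctional_skewRankOne, _root_.sub_apply, inner_sub_right,
        ContinuousLinearMap.comp_apply, ContinuousLinearMap.adjoint_inner_right,
        _root_.smul_apply, inner_smul_right, ContinuousLinearMap.id_apply,
        inner_self_eq_norm_sq_to_K] at h1 ⊢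
      -- The first equation only controls the real part; the imaginary part vanishes because the
      -- operator is self-adjoint.
      refine Complex.ext ?_ ?_
      · simp [pow_two] at h1 ⊢
        linarith
      · simp [pow_two]
  · rintro ⟨h1, h2⟩
    rw [hadj, h1, h2]
    refine ⟨?_, ?_, ?_⟩ <;> ext a
    · rw [traceFunctional_apply, traceFunctional_apply, ContinuousLinearMap.smul_comp, trace_smul,
        ← mul_assoc, Complex.ofReal_pow]
    · simp [traceFunctional_apply, trace]
    · simp [traceFunctional_apply, trace]

theorem levelMap_eq_zero_iff {k : ℝ} {p : TM Hp k} :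
    levelMap Hp k p = 0 ↔ p ∈ levelSet Hp k := by
  rw [mem_levelSet_iff, Prod.ext_iff]
  refine and_congr ⟨fun h => congrArg L1.op h, fun h => L1.ext h⟩
    ⟨fun h => sub_eq_zero.1 (congrArg (fun s : S1 Hp => L1.op s.1) h), fun h =>
      Subtype.ext (L1.ext (sub_eq_zero.2 h))⟩

/-! ### A right inverse of the differential with range orthogonal to its kernel -/

theorem op_S1 (B : S1 Hp) : adj (L1.op B.1) = L1.op B.1 := B.2

/-- The `g`-adjoint of the differential of the level map, up to a factor on the second argument:
`(A, B) ↦ (X A* + x B, x A - X B)`. -/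
noncomputable def normalMap {k : ℝ} (p : TM Hp k) : L1 Hp × S1 Hp →L[ℝ] Model Hp × Model Hp :=
  (((compModel p.1.2 p.2.2.2 ∘L L1.star).coprod
    (compModel p.1.1 p.2.1.2 ∘L (S1 Hp).subtypeL))).prod
  ((compModel p.1.1 p.2.1.2).coprod (-(compModel p.1.2 p.2.2.2 ∘L (S1 Hp).subtypeL)))

theorem opOf_neg (Z : Model Hp) : opOf (-Z) = -opOf Z := by
  have := opOf_real_smul (-1) Z
  simpa using this

theorem opOf_normalMap_fst {k : ℝ} (p : TM Hp k) (u : L1 Hp × S1 Hp) :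
    opOf (normalMap p u).1 = p.1.2 ∘L adj (L1.op u.1) + p.1.1 ∘L L1.op u.2.1 := by
  change opOf (compModel _ p.2.2.2 (L1.star u.1) + compModel _ p.2.1.2 u.2.1) = _
  rw [opOf_add, opOf_compModel, opOf_compModel, L1.op_star]

theorem opOf_normalMap_snd {k : ℝ} (p : TM Hp k) (u : L1 Hp × S1 Hp) :
    opOf (normalMap p u).2 = p.1.1 ∘L L1.op u.1 - p.1.2 ∘L L1.op u.2.1 := by
  change opOf (compModel _ p.2.1.2 u.1 + -compModel _ p.2.2.2 u.2.1) = _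
  rw [opOf_add, opOf_neg, opOf_compModel, opOf_compModel, sub_eq_add_neg]

/-- Conjugating the trace turns `C B` into `B* C* = -B C`, and cyclicity brings it back to `-C B`;
so the trace is purely imaginary. -/
theorem re_trace_comp_eq_zero {C B : Hp →L[ℂ] Hp} (hC : adj C = -C) (hB : adj B = B)
    (hBt : traceNorm B < ⊤) : (trace (C ∘L B)).re = 0 := by
  have h : (starRingEnd ℂ) (trace (C ∘L B)) = -trace (C ∘L B) := by
    rw [← trace_adjoint, ContinuousLinearMap.adjoint_comp, hC, hB, trace_comm hBt,
      ContinuousLinearMap.neg_comp, ← neg_one_smul ℂ (C ∘L B), trace_smul, neg_one_mul]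
  have h1 := congrArg Complex.re h
  rw [Complex.conj_re, Complex.neg_re] at h1
  linarith

/-- By cyclicity, the pairing of `w` with the normal vector of `(A, B)` is `Re Tr (D₁ A) + ½ Re Tr
(D₂ B)`, where `D₁` and `D₂` are the components of the differential at `w`. Both vanish on the
kernel. -/
theorem modelMetric_normalMap_eq_zero {k : ℝ} {p : TM Hp k} {w : Model Hp × Model Hp}
    (h1 : adj (opOf w.2) ∘L p.1.1 + adj p.1.2 ∘L opOf w.1 = 0)
    (h2 : adj p.1.1 ∘L opOf w.1 + adj (opOf w.1) ∘L p.1.1 -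
      (adj p.1.2 ∘L opOf w.2 + adj (opOf w.2) ∘L p.1.2) = 0) (u : L1 Hp × S1 Hp) :
    modelMetric Hp w (normalMap p u) = 0 := by
  rw [modelMetric_apply, reTraceForm_apply, reTraceForm_apply, opOf_normalMap_fst,
    opOf_normalMap_snd]
  obtain ⟨A, B⟩ := u
  dsimp only at h1 h2 ⊢
  set x := p.1.1
  set X := p.1.2
  set Z := opOf w.1
  set T := opOf w.2
  have fin : ∀ (C : Hp →L[ℂ] Hp) (A : L1 Hp), traceNorm (C ∘L L1.op A) < ⊤ := fun C A =>
    (L1.mulLeft C A).traceNorm_lt_top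
  have e1 : adj Z ∘L (X ∘L adj (L1.op A) + x ∘L L1.op B.1) =
      (adj Z ∘L X) ∘L L1.op (L1.star A) + (adj Z ∘L x) ∘L L1.op B.1 := by
    rw [ContinuousLinearMap.comp_add]; rfl
  have e2 : adj T ∘L (x ∘L L1.op A - X ∘L L1.op B.1) =
      (adj T ∘L x) ∘L L1.op A + (-(adj T ∘L X)) ∘L L1.op B.1 := by
    rw [ContinuousLinearMap.comp_sub, sub_eq_add_neg, ContinuousLinearMap.neg_comp]; rfl
  have e3 : (trace ((adj Z ∘L X) ∘L L1.op (L1.star A))).re =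
      -(trace ((adj T ∘L x) ∘L L1.op A)).re := by
    have e4 : adj Z ∘L X = -adj (adj T ∘L x) := by
      rw [eq_neg_of_add_eq_zero_left h1, map_neg, neg_neg, ContinuousLinearMap.adjoint_comp,
        ContinuousLinearMap.adjoint_adjoint]
    rw [e4, ContinuousLinearMap.neg_comp, L1.op_star, ← ContinuousLinearMap.adjoint_comp,
      ← neg_one_smul ℂ, trace_smul, trace_adjoint, trace_comm A.traceNorm_lt_top]
    simp
  -- The second kernel equation says exactly that `Z* x - T* X` is skew-Hermitian.
  have e5 : (trace ((adj Z ∘L x) ∘L L1.op B.1)).re +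
      (trace ((-(adj T ∘L X)) ∘L L1.op B.1)).re = 0 := by
    rw [← Complex.add_re, ← trace_add (fin _ _) (fin _ _), ← ContinuousLinearMap.add_comp]
    refine re_trace_comp_eq_zero ?_ B.2 B.1.traceNorm_lt_top
    rw [map_add, map_neg, ContinuousLinearMap.adjoint_comp, ContinuousLinearMap.adjoint_comp,
      ContinuousLinearMap.adjoint_adjoint, ContinuousLinearMap.adjoint_adjoint,
      eq_neg_iff_add_eq_zero, ← h2]
    abel
  rw [e1, e2, trace_add (fin _ _) (fin _ _), trace_add (fin _ _) (fin _ _), Complex.add_re,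
    Complex.add_re, e3]
  linarith

/-- The lower bounds are `0` and `c` in the first equation, and `c` on both sides in the second, so
both Sylvester operators are invertible. The first is solved for `A*`, whence the extra adjoint in
the solution operator. -/
theorem exists_sylvester_prod {M N : Hp →L[ℂ] Hp} {c : ℝ} (hc : 0 < c) (hM : 0 ≤ M)
    (hN : N = algebraMap ℝ (Hp →L[ℂ] Hp) c + M) :
    ∃ Q : L1 Hp × S1 Hp →L[ℝ] L1 Hp × S1 Hp, ∀ u,
      M ∘L adj (L1.op (Q u).1) + adj (L1.op (Q u).1) ∘L N = L1.op u.1 ∧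
      (N + M) ∘L L1.op (Q u).2.1 + L1.op (Q u).2.1 ∘L (N + M) = L1.op u.2.1 := by
  have hMsa : IsSelfAdjoint M := hM.isSelfAdjoint
  have hNsa : IsSelfAdjoint N := by
    rw [hN]; exact (IsSelfAdjoint.algebraMap _ (IsSelfAdjoint.all _)).add hMsa
  have hNle : algebraMap ℝ (Hp →L[ℂ] Hp) c ≤ N := by
    rw [hN]; exact le_add_of_nonneg_right hM
  have hle : algebraMap ℝ (Hp →L[ℂ] Hp) c ≤ N + M := hNle.trans (le_add_of_nonneg_right hM)
  have hsum : IsSelfAdjoint (N + M) := hNsa.add hMsa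
  obtain ⟨e₁, he₁⟩ := exists_sylvester (a := 0) hMsa hNsa (by rwa [map_zero]) hNle (by simpa)
  obtain ⟨e₂, he₂⟩ := exists_sylvester hsum hsum hle hle (by positivity)
  refine ⟨(L1.star ∘L (e₁.symm : L1 Hp →L[ℝ] L1 Hp)).prodMap
    (selfAdjointPart Hp ∘L (e₂.symm : L1 Hp →L[ℝ] L1 Hp) ∘L (S1 Hp).subtypeL), fun u => ?_⟩
  have hA := he₁ (e₁.symm u.1)
  have hB := he₂ (e₂.symm u.2.1)
  rw [ContinuousLinearEquiv.apply_symm_apply] at hA hB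
  have hadj : adj (N + M) = N + M := hsum
  -- Uniqueness: since `N + M` and the right-hand side are self-adjoint, the adjoint of a solution
  -- solves the same equation.
  have hBsa : L1.star (e₂.symm u.2.1) = e₂.symm u.2.1 := by
    refine e₂.injective (L1.ext ?_)
    rw [ContinuousLinearEquiv.apply_symm_apply, he₂, L1.op_star]
    have h4 := congrArg adj hB
    rw [op_S1, map_add, ContinuousLinearMap.adjoint_comp, ContinuousLinearMap.adjoint_comp,
      hadj, add_comm] at h4
    exact h4.symm
  have h1 : L1.op (L1.star (e₁.symm u.1)) = adj (L1.op (e₁.symm u.1)) := rfl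
  have h2 : (selfAdjointPart Hp (e₂.symm u.2.1)).1 = e₂.symm u.2.1 :=
    selfAdjointPart_of_mem (congrArg L1.op hBsa)
  change M ∘L adj (L1.op (L1.star (e₁.symm u.1))) + adj (L1.op (L1.star (e₁.symm u.1))) ∘L N = _ ∧
    (N + M) ∘L L1.op (selfAdjointPart Hp (e₂.symm u.2.1)).1 +
      L1.op (selfAdjointPart Hp (e₂.symm u.2.1)).1 ∘L (N + M) = _
  rw [h1, h2, ContinuousLinearMap.adjoint_adjoint]
  exact ⟨hA.symm, hB.symm⟩

/-- The differential of the level map on the range of `normalMap` is a Sylvester operator. -/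
theorem differential_normalMap {x X : Hp →L[ℂ] H} {A B : Hp →L[ℂ] Hp} (h : adj X ∘L x = 0)
    (hB : adj B = B) :
    adj (x ∘L A - X ∘L B) ∘L x + adj X ∘L (X ∘L adj A + x ∘L B) =
      (adj X ∘L X) ∘L adj A + adj A ∘L (adj x ∘L x) ∧
    adj x ∘L (X ∘L adj A + x ∘L B) + adj (X ∘L adj A + x ∘L B) ∘L x -
        (adj X ∘L (x ∘L A - X ∘L B) + adj (x ∘L A - X ∘L B) ∘L X) =
      (adj x ∘L x + adj X ∘L X) ∘L B + B ∘L (adj x ∘L x + adj X ∘L X) := by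
  -- Every mixed term contains `X* x` or `x* X`; only terms with `x* x` or `X* X` survive.
  have h' : adj x ∘L X = 0 := by
    have := congrArg adj h
    rwa [ContinuousLinearMap.adjoint_comp, ContinuousLinearMap.adjoint_adjoint, map_zero] at this
  have e1 : ∀ C : Hp →L[ℂ] Hp, adj X ∘L (x ∘L C) = 0 := fun C => by
    rw [← ContinuousLinearMap.comp_assoc, h, ContinuousLinearMap.zero_comp]
  have e2 : ∀ C : Hp →L[ℂ] Hp, adj x ∘L (X ∘L C) = 0 := fun C => by
    rw [← ContinuousLinearMap.comp_assoc, h', ContinuousLinearMap.zero_comp]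
  simp only [map_add, map_sub, ContinuousLinearMap.adjoint_comp,
    ContinuousLinearMap.adjoint_adjoint, hB, ContinuousLinearMap.comp_add,
    ContinuousLinearMap.add_comp, ContinuousLinearMap.comp_sub, ContinuousLinearMap.sub_comp,
    ContinuousLinearMap.comp_assoc, h, h', e1, e2, ContinuousLinearMap.comp_zero]
  constructor <;> abel

/-- At a point of the level set, the differential of the level map has a right inverse whose range
is `g`-orthogonal to the kernel. -/
theorem exists_rightInverse {k : ℝ} (hk : k ≠ 0) {p : TM Hp k} (hp : p ∈ levelSet Hp k)
    {D : Model Hp × Model Hp →L[ℝ] L1 Hp × S1 Hp}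
    (hD : ∀ w, L1.op (D w).1 = adj (opOf w.2) ∘L p.1.1 + adj p.1.2 ∘L opOf w.1 ∧
      L1.op (D w).2.1 = adj p.1.1 ∘L opOf w.1 + adj (opOf w.1) ∘L p.1.1 -
        (adj p.1.2 ∘L opOf w.2 + adj (opOf w.2) ∘L p.1.2)) :
    ∃ R : L1 Hp × S1 Hp →L[ℝ] Model Hp × Model Hp, (∀ u, D (R u) = u) ∧
      ∀ u w, D w = 0 → modelMetric Hp w (R u) = 0 := by
  obtain ⟨h1, h2⟩ := mem_levelSet_iff.1 hp
  -- On the level set `x* x = k² + X* X`, so the spectral gap is `k²`; it is positive because `k ≠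
  -- 0`.
  obtain ⟨Q, hQ⟩ := exists_sylvester_prod (M := adj p.1.2 ∘L p.1.2) (N := adj p.1.1 ∘L p.1.1)
    (c := k ^ 2) (by positivity)
    ((ContinuousLinearMap.nonneg_iff_isPositive _).2
      (ContinuousLinearMap.isPositive_adjoint_comp_self p.1.2))
    (by
      rw [← sub_eq_iff_eq_add, h2, Algebra.algebraMap_eq_smul_one]
      rfl)
  refine ⟨normalMap p ∘L Q, fun u => ?_, fun u w hw => ?_⟩
  · obtain ⟨hQ1, hQ2⟩ := hQ u
    obtain ⟨hD1, hD2⟩ := hD (normalMap p (Q u))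
    obtain ⟨e1, e2⟩ := differential_normalMap (A := L1.op (Q u).1) h1 (op_S1 (Q u).2)
    rw [opOf_normalMap_fst, opOf_normalMap_snd] at hD1 hD2
    exact Prod.ext (L1.ext ((hD1.trans e1).trans hQ1))
      (Subtype.ext (L1.ext ((hD2.trans e2).trans hQ2)))
  · obtain ⟨hD1, hD2⟩ := hD w
    rw [hw] at hD1 hD2
    exact modelMetric_normalMap_eq_zero hD1.symm hD2.symm (Q u)

end HyperkahlerGrassmannian

namespace HyperkahlerGrassmannian

variable {H : Type*} [NormedAddCommGroup H] [InnerProductSpace ℂ H] [CompleteSpace H]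
  {Hp : Submodule ℂ H} [CompleteSpace Hp]

/-! ### Straightening charts from the inverse function theorem -/

theorem exists_localDiffeo {V : Type*} [NormedAddCommGroup V] [NormedSpace ℝ V] [CompleteSpace V]
    {f : V → V} {z₀ : V} (hf : ContDiff ℝ ∞ f)
    (hf' : HasFDerivAt f (ContinuousLinearMap.id ℝ V) z₀) :
    ∃ ψ : OpenPartialHomeomorph V V, z₀ ∈ ψ.source ∧ ψ ∈ contDiffGroupoid ∞ 𝓘(ℝ, V) ∧
      ∀ z, ψ z = f z := by
  have hf'' : HasFDerivAt f ((ContinuousLinearEquiv.refl ℝ V : V ≃L[ℝ] V) : V →L[ℝ] V) z₀ := hf'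
  have h0 : (∞ : WithTop ℕ∞) ≠ 0 := by simp
  set θ := hf.contDiffAt.toOpenPartialHomeomorph f hf'' h0
  -- Membership in the smooth groupoid requires the inverse to be smooth on the whole target, not
  -- only near `f z₀`. Restricting to the open set where the derivative is invertible ensures this.
  set U : Set V := {z | IsUnit (fderiv ℝ f z)}
  have hU : IsOpen U := by
    exact Units.isOpen.preimage (hf.continuous_fderiv h0)
  refine ⟨θ.restrOpen U hU, ⟨hf.contDiffAt.mem_toOpenPartialHomeomorph_source hf'' h0, ?_⟩,
    ?_, fun z => rfl⟩
  · change IsUnit (fderiv ℝ f z₀)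
    rw [hf'.fderiv]
    exact isUnit_one
  · rw [contDiffGroupoid, mem_groupoid_of_pregroupoid]
    simp only [contDiffPregroupoid, modelWithCornersSelf_coe, modelWithCornersSelf_coe_symm,
      Function.id_comp, Function.comp_id, preimage_id, range_id, inter_univ]
    refine ⟨hf.contDiffOn, fun y hy => ContDiffAt.contDiffWithinAt ?_⟩
    have hy' := (θ.restrOpen U hU).map_target hy
    obtain ⟨u, hu⟩ : IsUnit (fderiv ℝ f ((θ.restrOpen U hU).symm y)) := hy'.2
    refine (θ.restrOpen U hU).contDiffAt_symm
      (f₀' := ContinuousLinearEquiv.unitsEquiv ℝ V u) hy ?_ hf.contDiffAt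
    have : ((ContinuousLinearEquiv.unitsEquiv ℝ V u : V ≃L[ℝ] V) : V →L[ℝ] V) =
        fderiv ℝ f ((θ.restrOpen U hU).symm y) := by
      rw [← hu]; rfl
    rw [this]
    exact (hf.differentiable h0 _).hasFDerivAt

/-- Near a point where the differential `D` of `F` has a continuous right inverse, some local
diffeomorphism straightens the zero set of `F` to the kernel of `D`. -/
theorem exists_straightening {V Y : Type*} [NormedAddCommGroup V] [NormedSpace ℝ V]
    [CompleteSpace V] [NormedAddCommGroup Y] [NormedSpace ℝ Y] {F : V → Y} {z₀ : V}
    (hF : ContDiff ℝ ∞ F) {D : V →L[ℝ] Y} (hD : HasFDerivAt F D z₀) {R : Y →L[ℝ] V}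
    (hR : ∀ u, D (R u) = u) :
    ∃ ψ : OpenPartialHomeomorph V V, z₀ ∈ ψ.source ∧ ψ ∈ contDiffGroupoid ∞ 𝓘(ℝ, V) ∧
      ∀ z, ψ z ∈ LinearMap.ker (D : V →ₗ[ℝ] Y) ↔ F z = 0 := by
  -- The derivative at `z₀` is `R D + (1 - R D) = 1`. Applying `D` to this map gives back `F`,
  -- because `D R = 1`, so it carries exactly the zeros of `F` into `ker D`.
  obtain ⟨ψ, hz, hψ, h⟩ := exists_localDiffeo (f := fun z => R (F z) + (z - R (D z))) (z₀ := z₀)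
    ((R.contDiff.comp hF).add (contDiff_id.sub (R.contDiff.comp D.contDiff)))
    (((R.hasFDerivAt.comp z₀ hD).add
      ((hasFDerivAt_id z₀).sub (R.hasFDerivAt.comp z₀ D.hasFDerivAt))).congr_fderiv (by
        ext v; simp))
  refine ⟨ψ, hz, hψ, fun z => ?_⟩
  rw [LinearMap.mem_ker, h]
  simp [hR]

/-! ### The manifold `TM_k` -/

/-- The atlas consists of the single global chart, so the only transition maps to check are `ψ` and
its inverse. -/
theorem trans_mem_maximalAtlas (k : ℝ)
    {ψ : OpenPartialHomeomorph (Model Hp × Model Hp) (Model Hp × Model Hp)}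
    (hψ : ψ ∈ contDiffGroupoid ∞ 𝓘(ℝ, Model Hp × Model Hp)) :
    (coordsHomeo k).toOpenPartialHomeomorph.trans ψ ∈
      IsManifold.maximalAtlas 𝓘(ℝ, Model Hp × Model Hp) ∞ (TM Hp k) := by
  rw [IsManifold.mem_maximalAtlas_iff, mem_maximalAtlas_iff]
  intro e he
  obtain rfl : e = (coordsHomeo k).toOpenPartialHomeomorph := he
  have h1 : (coordsHomeo k).toOpenPartialHomeomorph.symm.trans
      ((coordsHomeo k).toOpenPartialHomeomorph.trans ψ) = ψ := by
    refine OpenPartialHomeomorph.ext _ _ (fun x => ?_) (fun x => ?_) ?_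
    · simp
    · simp
    · ext x; simp
  refine ⟨?_, ?_⟩
  · rw [← OpenPartialHomeomorph.symm_symm ((coordsHomeo k).toOpenPartialHomeomorph),
      ← OpenPartialHomeomorph.trans_symm_eq_symm_trans_symm, OpenPartialHomeomorph.symm_symm, h1]
    exact (contDiffGroupoid ∞ _).symm hψ
  · rw [h1]
    exact hψ

theorem contMDiff_coords (k : ℝ) :
    ContMDiff 𝓘(ℝ, Model Hp × Model Hp) 𝓘(ℝ, Model Hp × Model Hp) ∞
      (coords k : TM Hp k → Model Hp × Model Hp) := fun p =>
  contMDiffAt_of_mem_maximalAtlas (IsManifold.chart_mem_maximalAtlas p) (mem_chart_source _ p)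

theorem contMDiff_levelMap (k : ℝ) :
    ContMDiff 𝓘(ℝ, Model Hp × Model Hp) 𝓘(ℝ, L1 Hp × S1 Hp) ∞ (levelMap Hp k) := by
  have h := (contDiff_levelMap_coords_symm (Hp := Hp) k).contMDiff.comp (contMDiff_coords k)
  refine h.congr fun p => ?_
  simp

theorem hasMFDerivAt_levelMap {k : ℝ} {p : TM Hp k}
    {D : Model Hp × Model Hp →L[ℝ] L1 Hp × S1 Hp}
    (hD : HasFDerivAt (fun z => levelMap Hp k ((coords k).symm z)) D (coords k p)) :
    HasMFDerivAt 𝓘(ℝ, Model Hp × Model Hp) 𝓘(ℝ, L1 Hp × S1 Hp) (levelMap Hp k) p D :=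
  ⟨(contMDiff_levelMap k).continuous.continuousAt, hD.hasFDerivWithinAt⟩

theorem isSmoothSubmanifold_levelSet {k : ℝ} (hk : k ≠ 0) :
    IsSmoothSubmanifold (V := Model Hp × Model Hp) (levelSet Hp k) := by
  intro p hp
  obtain ⟨D, hD, hD'⟩ := exists_hasFDerivAt_levelMap k p
  obtain ⟨R, hR, -⟩ := exists_rightInverse hk hp hD'
  obtain ⟨ψ, hz, hψ, h⟩ := exists_straightening (contDiff_levelMap_coords_symm k) hD hR
  have hiff : ∀ q : TM Hp k, ψ (coords k q) ∈ LinearMap.ker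
      (D : Model Hp × Model Hp →ₗ[ℝ] L1 Hp × S1 Hp) ↔ q ∈ levelSet Hp k := fun q => by
    rw [h, Equiv.symm_apply_apply, levelMap_eq_zero_iff]
  refine ⟨LinearMap.ker (D : Model Hp × Model Hp →ₗ[ℝ] L1 Hp × S1 Hp),
    (coordsHomeo k).toOpenPartialHomeomorph.trans ψ, ⟨trans_mem_maximalAtlas k hψ, ?_, ?_⟩, ?_⟩
  · exact (ContinuousLinearMap.isTopCompl_range_ker_of_leftInverse R D hR).symm.closedComplemented
  · ext y
    constructor
    · rintro ⟨q, ⟨hq, hqS⟩, rfl⟩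
      exact ⟨OpenPartialHomeomorph.map_source _ hq, (hiff q).2 hqS⟩
    · rintro ⟨hy, hyA⟩
      set φ := (coordsHomeo k).toOpenPartialHomeomorph.trans ψ
      refine ⟨φ.symm y, ⟨φ.map_target hy, (hiff _).1 ?_⟩, φ.right_inv hy⟩
      change φ (φ.symm y) ∈ _
      rw [φ.right_inv hy]
      exact hyA
  · exact ⟨mem_univ _, hz⟩

/-! ### The orthogonal complement of the kernel. -/

theorem isTopCompl_ker_formOrthogonal {V Y : Type*} [NormedAddCommGroup V] [NormedSpace ℝ V]
    [NormedAddCommGroup Y] [NormedSpace ℝ Y] {D : V →L[ℝ] Y} {R : Y →L[ℝ] V}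
    (hR : ∀ u, D (R u) = u) {b : V →L[ℝ] V →L[ℝ] ℝ} (hb : ∀ v, v ≠ 0 → 0 < b v v)
    (hort : ∀ u w, D w = 0 → b w (R u) = 0) :
    Submodule.IsTopCompl (LinearMap.ker (D : V →ₗ[ℝ] Y))
      (formOrthogonal b (LinearMap.ker (D : V →ₗ[ℝ] Y))) := by
  have h : formOrthogonal b (LinearMap.ker (D : V →ₗ[ℝ] Y)) =
      LinearMap.range (R : Y →ₗ[ℝ] V) := by
    ext v
    constructor
    · intro hv
      -- If `v` is orthogonal to the kernel, then `v - R (D v)` lies in the kernel and is orthogonal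
      -- to it, hence vanishes by definiteness. So the orthogonal is no larger than the range of
      -- `R`.
      have hw : D (v - R (D v)) = 0 := by rw [map_sub, hR, sub_self]
      have h0 : b (v - R (D v)) (v - R (D v)) = 0 := by
        rw [map_sub, hort _ _ hw, hv _ hw, sub_zero]
      have h1 : v - R (D v) = 0 := by
        by_contra hne
        exact (hb _ hne).ne' h0
      exact ⟨D v, (sub_eq_zero.1 h1).symm⟩
    · rintro ⟨u, rfl⟩ w hw
      exact hort u w hw
  rw [h]
  exact (ContinuousLinearMap.isTopCompl_range_ker_of_leftInverse R D hR).symm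

/-! ### The restricted metric -/

section Chart

variable {k : ℝ} {φ : OpenPartialHomeomorph (TM Hp k) (Model Hp × Model Hp)}

/-- The metric has constant coefficients in the global chart, so reading the derivative there as an
ordinary Fréchet derivative reduces smoothness of the restricted metric to smoothness of `fderiv`.
-/
theorem mfderiv_symm_eq
    (hφ : φ ∈ IsManifold.maximalAtlas 𝓘(ℝ, Model Hp × Model Hp) ∞ (TM Hp k))
    {y : Model Hp × Model Hp} (hy : y ∈ φ.target) :
    mfderiv 𝓘(ℝ, Model Hp × Model Hp) 𝓘(ℝ, Model Hp × Model Hp) φ.symm y =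
      fderiv ℝ (fun z => coords k (φ.symm z)) y := by
  have h := (contMDiffAt_symm_of_mem_maximalAtlas hφ hy).mdifferentiableAt (by simp)
  let D : Model Hp × Model Hp →L[ℝ] Model Hp × Model Hp :=
    mfderiv 𝓘(ℝ, Model Hp × Model Hp) 𝓘(ℝ, Model Hp × Model Hp) φ.symm y
  have h1 : HasFDerivWithinAt (fun z => coords k (φ.symm z)) D
      (range (id : Model Hp × Model Hp → Model Hp × Model Hp)) y := h.hasMFDerivAt.2
  rw [range_id] at h1
  exact (h1.hasFDerivAt univ_mem).fderiv.symm

theorem contDiffOn_coords_symm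
    (hφ : φ ∈ IsManifold.maximalAtlas 𝓘(ℝ, Model Hp × Model Hp) ∞ (TM Hp k)) :
    ContDiffOn ℝ ∞ (fun z => coords k (φ.symm z)) φ.target :=
  contMDiffOn_iff_contDiffOn.1
    ((contMDiff_coords k).comp_contMDiffOn (contMDiffOn_symm_of_mem_maximalAtlas hφ))

theorem mfderiv_symm_injective
    (hφ : φ ∈ IsManifold.maximalAtlas 𝓘(ℝ, Model Hp × Model Hp) ∞ (TM Hp k))
    {y : Model Hp × Model Hp} (hy : y ∈ φ.target) :
    Function.Injective
      (mfderiv 𝓘(ℝ, Model Hp × Model Hp) 𝓘(ℝ, Model Hp × Model Hp) φ.symm y) := by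
  have h : φ.MDifferentiable 𝓘(ℝ, Model Hp × Model Hp) 𝓘(ℝ, Model Hp × Model Hp) :=
    ⟨(contMDiffOn_of_mem_maximalAtlas hφ).mdifferentiableOn (by simp),
      (contMDiffOn_symm_of_mem_maximalAtlas hφ).mdifferentiableOn (by simp)⟩
  exact h.symm.mfderiv_injective hy

end Chart

theorem isRiemannianSubmanifold_levelSet {k : ℝ} (hk : k ≠ 0) :
    IsRiemannianSubmanifold (metric Hp k) (levelSet Hp k) := by
  refine ⟨isSmoothSubmanifold_levelSet hk, fun A φ hφ => ⟨?_, fun y hy => ⟨fun u v => ?_,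
    fun u hu => ?_⟩⟩⟩
  · have hopen : IsOpen {y : A | (y : Model Hp × Model Hp) ∈ φ.target} :=
      φ.open_target.preimage continuous_subtype_val
    have h1 : ContDiffOn ℝ ∞ (fderiv ℝ fun z => coords k (φ.symm z)) φ.target :=
      (contDiffOn_coords_symm hφ.mem_maximalAtlas).fderiv_of_isOpen φ.open_target (by simp)
    have h2 : ContDiffOn ℝ ∞
        (fun y : A => (fderiv ℝ (fun z => coords k (φ.symm z)) (y : Model Hp × Model Hp)) ∘L
          A.subtypeL) {y : A | (y : Model Hp × Model Hp) ∈ φ.target} :=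
      (h1.comp A.subtypeL.contDiff.contDiffOn fun y hy => hy).clm_comp contDiffOn_const
    have h3 : ContDiffOn ℝ ∞ (fun y : A => (modelMetric Hp).bilinearComp
        ((fderiv ℝ (fun z => coords k (φ.symm z)) (y : Model Hp × Model Hp)) ∘L A.subtypeL)
        ((fderiv ℝ (fun z => coords k (φ.symm z)) (y : Model Hp × Model Hp)) ∘L A.subtypeL))
        {y : A | (y : Model Hp × Model Hp) ∈ φ.target} := by
      -- The point-dependent derivative is inserted into one argument of the form at a time;
      -- flipping the arguments turns each insertion into a composition of linear maps.
      have hflip : ∀ f : A → A →L[ℝ] (Model Hp × Model Hp) →L[ℝ] ℝ,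
          ContDiffOn ℝ ∞ f {y : A | (y : Model Hp × Model Hp) ∈ φ.target} →
          ContDiffOn ℝ ∞ (fun y => (f y).flip) {y : A | (y : Model Hp × Model Hp) ∈ φ.target} :=
        fun f hf => (ContinuousLinearMap.flipₗᵢ ℝ A (Model Hp × Model Hp)
          ℝ).toContinuousLinearEquiv.contDiff.comp_contDiffOn hf
      refine (ContinuousLinearMap.flipₗᵢ ℝ A A
          ℝ).toContinuousLinearEquiv.contDiff.comp_contDiffOn
        ((hflip _ (contDiffOn_const.clm_comp h2)).clm_comp h2)
    refine h3.congr fun y hy => ?_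
    simp only [inducedForm]
    rw [mfderiv_symm_eq hφ.mem_maximalAtlas hy]
    rfl
  · exact modelMetric_symm _ _
  -- The derivative of the inverse chart is injective, so a nonzero `u` has nonzero image.
  · refine modelMetric_self_pos fun h => hu ?_
    have h1 := mfderiv_symm_injective hφ.mem_maximalAtlas hy
    exact Subtype.ext (h1 (h.trans (map_zero _).symm))

end HyperkahlerGrassmannian

/-- The level set `W_k = μ⁻¹(-(i/2) k² Tr, 0, 0)` is a smooth Riemannian submanifold of `TM_k`; the
map `(x, X) ↦ (X* x, x* x - X* X)` is smooth, and at every point of `W_k` its differential is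
surjective and its kernel has the `g`-orthogonal complement as a closed complement. -/
theorem theorem3p2 {H : Type*} [NormedAddCommGroup H] [InnerProductSpace ℂ H] [CompleteSpace H]
    [TopologicalSpace.SeparableSpace H]
    (Hp : Submodule ℂ H) [CompleteSpace Hp]
    (hp : ¬ FiniteDimensional ℂ Hp) (hm : ¬ FiniteDimensional ℂ Hpᗮ)
    (k : ℝ) (hk : k ≠ 0) :
    IsRiemannianSubmanifold (metric Hp k) (levelSet Hp k) ∧
    ContMDiff 𝓘(ℝ, Model Hp × Model Hp) 𝓘(ℝ, L1 Hp × S1 Hp) ∞ (levelMap Hp k) ∧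
    ∀ p ∈ levelSet Hp k,
      Function.Surjective
        (mfderiv 𝓘(ℝ, Model Hp × Model Hp) 𝓘(ℝ, L1 Hp × S1 Hp) (levelMap Hp k) p) ∧
      Submodule.IsTopCompl
        (LinearMap.ker
          (mfderiv 𝓘(ℝ, Model Hp × Model Hp) 𝓘(ℝ, L1 Hp × S1 Hp)
            (levelMap Hp k) p).toLinearMap)
        (formOrthogonal (metric Hp k p)
          (LinearMap.ker
            (mfderiv 𝓘(ℝ, Model Hp × Model Hp) 𝓘(ℝ, L1 Hp × S1 Hp)
              (levelMap Hp k) p).toLinearMap)) := by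
  refine ⟨isRiemannianSubmanifold_levelSet hk, contMDiff_levelMap k, fun p hpS => ?_⟩
  obtain ⟨D, hD, hD1⟩ := exists_hasFDerivAt_levelMap k p
  obtain ⟨R, hR, hort⟩ := exists_rightInverse hk hpS hD1
  rw [(hasMFDerivAt_levelMap hD).mfderiv]
  exact ⟨fun u => ⟨R u, hR u⟩,
    isTopCompl_ker_formOrthogonal hR (fun v hv => modelMetric_self_pos hv) hort⟩
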